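/- Let $d\ge 1$ be an integer. A measurement $\Lambda$ of a qudit $\mathbb C^d$ with $N$ outcomes is given by positive semidefinite $d\times d$ matrices $M_1,\dots,M_N$ with $\sum_x M_x=I$; for an operator $\xi$ on $(\mathbb C^d)^{\otimes k}$ let $\Lambda^{\otimes k}(\xi)$ be the vector with the entries $\operatorname{tr}\big((M_{x_1}\otimes\cdots\otimes M_{x_k})\,\xi\big)$, $x\in\{1,\dots,N\}^k$, and let $\|\Lambda^{\otimes k}(\xi)\|_1$ be the sum of their moduli. Let $\|\xi\|_1$ be the trace norm. Call $\Lambda$ tomographic if $N\le d^8$ and $$\frac{1}{(18d)^{k/2}}\,\|\xi\|_1\le\|\Lambda^{\otimes k}(\xi)\|_1\qquad\text{for every integer }k\ge 1\text{ and every traceless operator }\xi\text{ on }(\mathbb C^d)^{\otimes k}.$$ **Theorem (quantum de Finetti theorem without symmetry).** A tomographic measurement of $\mathbb C^d$ exists. Moreover, let $\Lambda$ be any tomographic measurement of $\mathbb C^d$, let $n,k\ge 0$ be integers, let $\rho=\rho^{Q_1\ldots Q_n}$ be a density matrix on $(\mathbb C^d)^{\otimes n}$, and let $t$ be an integer with $1\le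 t\le n-k$. Then there is an integer $m$ with $0\le m\le t$ such that $$\mathop{\mathbb E}_{\vec j,\,\vec x}\ \mathop{\mathbb E}_{\vec i}\ \Big\|\rho_{\vec j,\vec x}^{Q_{i_1}\ldots Q_{i_k}}-\rho_{\vec j,\vec x}^{Q_{i_1}}\otimes\cdots\otimes\rho_{\vec j,\vec x}^{Q_{i_k}}\Big\|_1^2\ \le\ \frac{4\ln(d)\,(18d)^k\,k^2}{t}.$$ Here $\vec j=(j_1,\dots,j_m)$ and $\vec i=(i_1,\dots,i_k)$ are uniformly random disjoint tuples of distinct elements of $\{1,\dots,n\}$; $\vec x=(x_1,\dots,x_m)$ are the outcomes of measuring each of the sites $Q_{j_1},\dots,Q_{j_m}$ of $\rho$ with $\Lambda$; $\rho_{\vec j,\vec x}$ is the post-measurement state of the remaining $n-m$ sites, conditioned on the outcomes $\vec x$; and superscripts denote reduced states (partial trace over all other sites). -/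

import Mathlib

open scoped BigOperators Matrix ComplexOrder

noncomputable section

namespace DeFinetti

/-- Operators on `(ℂ^d)^{⊗ ι}`: one qudit for every site in `ι`, written as matrices in the
product basis, whose elements are indexed by the functions `ι → Fin d`. -/
abbrev QuditOp (d : ℕ) (ι : Type) : Type := Matrix (ι → Fin d) (ι → Fin d) ℂ

/-- Density operators: positive semidefinite of trace one. -/
def IsDensity {d : ℕ} {ι : Type} [Fintype ι] [DecidableEq ι] (ρ : QuditOp d ι) : Prop :=
  ρ.PosSemidef ∧ ρ.trace = 1

/-- The trace norm `‖A‖₁ = tr √(A* A)`: the sum of the singular values of `A`, i.e. of the square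
roots of the eigenvalues of `A* A`. -/
def traceNorm {β : Type} [Fintype β] [DecidableEq β] (A : Matrix β β ℂ) : ℝ :=
  ∑ b, Real.sqrt ((Matrix.isHermitian_conjTranspose_mul_self A).eigenvalues b)

/-- The tensor product `⨂_{l} A_l` of one-qudit operators. -/
def tensorOp {d : ℕ} {κ : Type} [Fintype κ] (A : κ → Matrix (Fin d) (Fin d) ℂ) : QuditOp d κ :=
  Matrix.of fun a b => ∏ l, A l (a l) (b l)

/-- A measurement of a qudit with `N` outcomes (a POVM). -/
structure Measurement (d N : ℕ) where
  effect : Fin N → Matrix (Fin d) (Fin d) ℂ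
  posSemidef : ∀ x, (effect x).PosSemidef
  sum_eq_one : ∑ x, effect x = 1

/-- `Λ^{⊗ κ}(ξ)`, as the function `x ↦ tr((⨂_l M_{x_l}) ξ)` of the outcomes. (The operator
`Λ^{⊗ κ}(ξ)` is diagonal in the outcome basis, with these diagonal entries.) -/
def Measurement.apply {d N : ℕ} (M : Measurement d N) {κ : Type} [Fintype κ] [DecidableEq κ]
    (ξ : QuditOp d κ) (x : κ → Fin N) : ℂ :=
  (tensorOp (fun l => M.effect (x l)) * ξ).trace

/-- At most `d ^ 8` outcomes, and
`‖ξ‖₁ / (18 d)^{k/2} ≤ ‖Λ^{⊗ k}(ξ)‖₁` for all `k ≥ 1` and all traceless operators `ξ` on `k` qudits.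
The 1-norm of the diagonal operator `Λ^{⊗ k}(ξ)` is the sum of the moduli of its entries. -/
def Measurement.IsTomographic {d N : ℕ} (M : Measurement d N) : Prop :=
  N ≤ d ^ 8 ∧
    ∀ k : ℕ, 0 < k → ∀ ξ : QuditOp d (Fin k), ξ.trace = 0 →
      1 / (18 * (d : ℝ)) ^ ((k : ℝ) / 2) * traceNorm ξ ≤ ∑ x : Fin k → Fin N, ‖M.apply ξ x‖

/-- The reduced operator on the (ordered) sites `i`: the partial trace over all other sites. -/
def marginal {d : ℕ} {ι κ : Type} [Fintype ι] [DecidableEq ι] [Fintype κ]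
    (ρ : QuditOp d ι) (i : κ ↪ ι) : QuditOp d κ :=
  Matrix.of fun a b => ∑ u : ι → Fin d, ∑ v : ι → Fin d,
    if (∀ l, u (i l) = a l) ∧ (∀ l, v (i l) = b l) ∧ (∀ s, (∀ l, i l ≠ s) → u s = v s)
    then ρ u v else 0

/-- The reduced operator on the single site `s`. -/
def siteMarginal {d : ℕ} {ι : Type} [Fintype ι] [DecidableEq ι]
    (ρ : QuditOp d ι) (s : ι) : Matrix (Fin d) (Fin d) ℂ :=
  Matrix.of fun a b =>
    marginal ρ ⟨fun _ : Unit => s, fun _ _ _ => rfl⟩ (fun _ => a) (fun _ => b)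

/-- The sites that are not among `j_1, …, j_m`. -/
abbrev Rest {n m : ℕ} (j : Fin m ↪ Fin n) : Type := {s : Fin n // ∀ l, j l ≠ s}

/-- The unnormalized state `tr_{Q_j} ((M_{x_1} ⊗ ⋯ ⊗ M_{x_m})^{Q_j} ρ)` on the remaining sites
after measuring the sites `j_1, …, j_m` with outcomes `x_1, …, x_m`. -/
def unnormalizedPost {d N n m : ℕ} (M : Measurement d N) (ρ : QuditOp d (Fin n))
    (j : Fin m ↪ Fin n) (x : Fin m → Fin N) : QuditOp d (Rest j) :=
  Matrix.of fun a b => ∑ u : Fin n → Fin d, ∑ v : Fin n → Fin d,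
    if (∀ s : Rest j, u s = a s) ∧ (∀ s : Rest j, v s = b s)
    then (∏ l, M.effect (x l) (v (j l)) (u (j l))) * ρ u v else 0

/-- The probability of the outcomes `x` when the sites `j` are measured. -/
def outcomeProb {d N n m : ℕ} (M : Measurement d N) (ρ : QuditOp d (Fin n))
    (j : Fin m ↪ Fin n) (x : Fin m → Fin N) : ℝ :=
  (unnormalizedPost M ρ j x).trace.re

/-- The post-measurement state `ρ_{j,x}` of the remaining sites, conditioned on the outcomes `x`
(meaningful for outcomes of positive probability; the others have weight zero below). -/
def postState {d N n m : ℕ} (M : Measurement d N) (ρ : QuditOp d (Fin n))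
    (j : Fin m ↪ Fin n) (x : Fin m → Fin N) : QuditOp d (Rest j) :=
  ((outcomeProb M ρ j x : ℝ) : ℂ)⁻¹ • unnormalizedPost M ρ j x

/-- `𝔼_{j,x} 𝔼_i ‖ρ_{j,x}^{Q_{i_1} ⋯ Q_{i_k}} - ρ_{j,x}^{Q_{i_1}} ⊗ ⋯ ⊗ ρ_{j,x}^{Q_{i_k}}‖₁²`, where
`j` is a uniformly random ordered `m`-subset of the sites, `x` are the outcomes of measuring the
sites `j`, and `i` is a uniformly random ordered `k`-subset of the remaining sites. -/
def meanSqDistToProduct {d N n : ℕ} (M : Measurement d N) (ρ : QuditOp d (Fin n)) (k m : ℕ) : ℝ :=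
  𝔼 j : Fin m ↪ Fin n, ∑ x : Fin m → Fin N, outcomeProb M ρ j x *
    𝔼 i : Fin k ↪ Rest j,
      traceNorm (marginal (postState M ρ j x) i
        - tensorOp (fun l => siteMarginal (postState M ρ j x) (i l))) ^ 2

end DeFinetti

end

open scoped BigOperators Matrix ComplexOrder

namespace DeFinetti

/-! ### Tensor powers of a linear map into a weighted function space -/

/-! Existence of a tomographic measurement. Take effects `w_x v_x v_x*`, where the weighted vectors
have the moments of a complex Gaussian vector in bidegrees (1,1), (2,2) and (4,4). The first moments
make the effects sum to the identity. For `f(x) = ⟨v_x, ξ v_x⟩` the second moments give `‖f‖₂² = |tr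
ξ|² + ‖ξ‖_HS² ≥ ‖ξ‖_HS²` (`HasGaussianMoments.second_moment`), and the fourth moments give `‖f‖₄⁴ ≤
18 ‖f‖₂⁴` (`HasGaussianMoments.fourth_moment_le`). Both inequalities pass to tensor powers, and
interpolating L² between L¹ and L⁴ yields `‖ξ‖_HS ≤ 18^{k/2} ‖f‖₁`
(`sum_norm_sq_le_sq_tensorApply`). Passing from the Hilbert–Schmidt norm to the trace norm costs the
factor `d^{k/2}`. Carathéodory's theorem reduces the number of vectors to at most `d^8`.

The de Finetti bound. Let `p` be the classical distribution of the outcomes when all sites are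
measured. The tomographic bound replaces the squared trace distance by `(18 d)^k` times the squared
ℓ¹ distance between a conditional law of `p` and the product of its marginals. A Pinsker-type
inequality bounds that, on average over the conditioning outcomes, by four times a conditional total
correlation (`sum_margProb_mul_sq_le_totalCorrelation`). Averaged over random sites, the total
correlation is `A(m+k) - A(m) - k (A(m+1) - A(m))`, where `A(r)` is the mean negative entropy of `r`
random outcomes (`expect_totalCorrelation`).

Every increment of `A` lies in one fixed interval of length `log d`, however many outcomes there
are: `M_c ≤ tr(M_c) I` makes each conditional outcome law at most `d` times the fixed law `q(c) =
tr(M_c) / d` (`meanNegEntropy_succ_sub`). Hence the sum over `0 ≤ m ≤ t` telescopes to at most `k²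
log d`, and some `m` achieves the average (`exists_second_difference_le`). -/

theorem sum_fin_succ_pi {X R : Type*} [Fintype X] [AddCommMonoid R] {k : ℕ}
    (f : (Fin (k + 1) → X) → R) :
    ∑ x, f x = ∑ a, ∑ y : Fin k → X, f (Fin.cons a y) := by
  rw [← (Fin.consEquiv fun _ : Fin (k + 1) => X).sum_comp, Fintype.sum_prod_type]
  rfl

/-- Minkowski's inequality in weighted `L²`. -/
theorem sum_weighted_sq_sum_le {X Y : Type*} [Fintype X] [Fintype Y] {w : X → ℝ}
    (hw : ∀ x, 0 ≤ w x) {u : Y → ℝ} (hu : ∀ y, 0 ≤ u y) (g : X → Y → ℝ) {c : X → ℝ}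
    (hc : ∀ x, 0 ≤ c x) (h : ∀ x, ∑ y, u y * g x y ^ 2 ≤ c x ^ 2) :
    ∑ y, u y * (∑ x, w x * g x y) ^ 2 ≤ (∑ x, w x * c x) ^ 2 := by
  have key : ∀ x x', ∑ y, u y * (g x y * g x' y) ≤ c x * c x' := by
    intro x x'
    refine le_of_sq_le_sq ?_ (mul_nonneg (hc x) (hc x'))
    have h1 := Finset.sum_mul_sq_le_sq_mul_sq Finset.univ (fun y => Real.sqrt (u y) * g x y)
      (fun y => Real.sqrt (u y) * g x' y)
    have e : ∀ z z' : X, ∑ y, (Real.sqrt (u y) * g z y) * (Real.sqrt (u y) * g z' y)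
        = ∑ y, u y * (g z y * g z' y) := fun z z' => Finset.sum_congr rfl fun y _ => by
      linear_combination (g z y * g z' y) * Real.mul_self_sqrt (hu y)
    have e2 : ∀ z : X, ∑ y, (Real.sqrt (u y) * g z y) ^ 2 = ∑ y, u y * g z y ^ 2 :=
      fun z => Finset.sum_congr rfl fun y _ => by
        linear_combination (g z y ^ 2) * Real.mul_self_sqrt (hu y)
    rw [e, e2, e2] at h1
    refine h1.trans ?_
    rw [mul_pow]
    exact mul_le_mul (h x) (h x')
      (Finset.sum_nonneg fun y _ => mul_nonneg (hu y) (sq_nonneg _)) (sq_nonneg _)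
  have e : ∑ y, u y * (∑ x, w x * g x y) ^ 2
      = ∑ x, ∑ x', w x * w x' * ∑ y, u y * (g x y * g x' y) := by
    simp_rw [Finset.mul_sum]
    rw [Finset.sum_congr rfl fun x _ => Finset.sum_comm, Finset.sum_comm]
    refine Finset.sum_congr rfl fun y _ => ?_
    rw [sq, Finset.sum_mul_sum, Finset.mul_sum]
    refine Finset.sum_congr rfl fun x _ => ?_
    rw [Finset.mul_sum]
    exact Finset.sum_congr rfl fun x' _ => by ring
  rw [e, sq, Finset.sum_mul_sum]
  refine Finset.sum_le_sum fun x _ => Finset.sum_le_sum fun x' _ => ?_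
  calc _ ≤ w x * w x' * (c x * c x') :=
        mul_le_mul_of_nonneg_left (key x x') (mul_nonneg (hw x) (hw x'))
    _ = _ := by ring

section TensorPowers

variable {X J : Type*} [Fintype J]

/-- The `k`-th tensor power of the linear map with the matrix `T`. -/
noncomputable def tensorApply (T : X → J → ℂ) {k : ℕ} (G : (Fin k → J) → ℂ) (x : Fin k → X) : ℂ :=
  ∑ j, (∏ l, T (x l) (j l)) * G j

theorem tensorApply_cons (T : X → J → ℂ) {k : ℕ} (G : (Fin (k + 1) → J) → ℂ) (a : X)
    (x : Fin k → X) :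
    tensorApply T G (Fin.cons a x)
      = ∑ b, T a b * tensorApply T (fun j => G (Fin.cons b j)) x := by
  simp only [tensorApply, sum_fin_succ_pi, Fin.prod_univ_succ, Fin.cons_zero, Fin.cons_succ,
    Finset.mul_sum, mul_assoc]

theorem tensorApply_cons' (T : X → J → ℂ) {k : ℕ} (G : (Fin (k + 1) → J) → ℂ) (a : X)
    (x : Fin k → X) :
    tensorApply T G (Fin.cons a x)
      = tensorApply T (fun j => ∑ b, T a b * G (Fin.cons b j)) x := by
  rw [tensorApply_cons]
  simp only [tensorApply, Finset.mul_sum]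
  rw [Finset.sum_comm]
  exact Finset.sum_congr rfl fun j _ => Finset.sum_congr rfl fun b _ => by ring

/-- Induction on the number of factors: the induction hypothesis treats the last `k` coordinates for
each fixed first index `b`, and `hT` then treats the first coordinate for each fixed `x`. -/
theorem sum_norm_sq_le_tensorApply [Fintype X] {T : X → J → ℂ} {w : X → ℝ} (hw : ∀ x, 0 ≤ w x)
    (hT : ∀ η : J → ℂ, ∑ j, ‖η j‖ ^ 2 ≤ ∑ x, w x * ‖∑ j, T x j * η j‖ ^ 2) :
    ∀ (k : ℕ) (G : (Fin k → J) → ℂ),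
      ∑ j, ‖G j‖ ^ 2 ≤ ∑ x : Fin k → X, (∏ l, w (x l)) * ‖tensorApply T G x‖ ^ 2
  | 0, G => by simp [tensorApply]
  | k + 1, G => by
    rw [sum_fin_succ_pi, sum_fin_succ_pi]
    simp only [Fin.prod_univ_succ, Fin.cons_zero, Fin.cons_succ]
    calc ∑ b, ∑ j : Fin k → J, ‖G (Fin.cons b j)‖ ^ 2
        ≤ ∑ b, ∑ x : Fin k → X, (∏ l, w (x l)) *
            ‖tensorApply T (fun j => G (Fin.cons b j)) x‖ ^ 2 :=
          Finset.sum_le_sum fun b _ => sum_norm_sq_le_tensorApply hw hT k _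
      _ = ∑ x : Fin k → X, (∏ l, w (x l)) *
            ∑ b, ‖tensorApply T (fun j => G (Fin.cons b j)) x‖ ^ 2 := by
          rw [Finset.sum_comm]; simp only [Finset.mul_sum]
      _ ≤ ∑ x : Fin k → X, (∏ l, w (x l)) *
            ∑ a, w a * ‖tensorApply T G (Fin.cons a x)‖ ^ 2 := by
          refine Finset.sum_le_sum fun x _ =>
            mul_le_mul_of_nonneg_left ?_ (Finset.prod_nonneg fun l _ => hw _)
          simp only [tensorApply_cons]
          exact hT _
      _ = _ := by
          rw [Finset.sum_comm]
          refine Finset.sum_congr rfl fun x _ => ?_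
          rw [Finset.mul_sum]
          exact Finset.sum_congr rfl fun a _ => by ring

/-- The usual tensorisation of hypercontractive estimates: `hT` is applied in the first coordinate
with the others fixed, and Minkowski's inequality exchanges the two norms so that the induction
hypothesis applies with the first outcome fixed. -/
theorem tensorApply_fourth_moment [Fintype X] {T : X → J → ℂ} {w : X → ℝ} (hw : ∀ x, 0 ≤ w x) {C : ℝ}
    (hC : 0 ≤ C)
    (hT : ∀ η : J → ℂ, ∑ x, w x * ‖∑ j, T x j * η j‖ ^ 4
      ≤ C ^ 2 * (∑ x, w x * ‖∑ j, T x j * η j‖ ^ 2) ^ 2) :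
    ∀ (k : ℕ) (G : (Fin k → J) → ℂ),
      ∑ x : Fin k → X, (∏ l, w (x l)) * ‖tensorApply T G x‖ ^ 4
        ≤ (C ^ k * ∑ x : Fin k → X, (∏ l, w (x l)) * ‖tensorApply T G x‖ ^ 2) ^ 2
  | 0, G => by simp [tensorApply, ← pow_mul]
  | k + 1, G => by
    have hw' : ∀ x : Fin k → X, 0 ≤ ∏ l, w (x l) := fun x => Finset.prod_nonneg fun l _ => hw _
    rw [sum_fin_succ_pi, sum_fin_succ_pi]
    simp only [Fin.prod_univ_succ, Fin.cons_zero, Fin.cons_succ]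
    calc ∑ a, ∑ x : Fin k → X, w a * (∏ l, w (x l)) * ‖tensorApply T G (Fin.cons a x)‖ ^ 4
        = ∑ x : Fin k → X, (∏ l, w (x l)) * ∑ a, w a * ‖tensorApply T G (Fin.cons a x)‖ ^ 4 := by
          rw [Finset.sum_comm]
          refine Finset.sum_congr rfl fun x _ => ?_
          rw [Finset.mul_sum]
          exact Finset.sum_congr rfl fun a _ => by ring
      _ ≤ ∑ x : Fin k → X, (∏ l, w (x l)) *
            (C ^ 2 * (∑ a, w a * ‖tensorApply T G (Fin.cons a x)‖ ^ 2) ^ 2) := by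
          refine Finset.sum_le_sum fun x _ => mul_le_mul_of_nonneg_left ?_ (hw' x)
          simp only [tensorApply_cons]
          exact hT _
      _ = C ^ 2 * ∑ x : Fin k → X, (∏ l, w (x l)) *
            (∑ a, w a * ‖tensorApply T G (Fin.cons a x)‖ ^ 2) ^ 2 := by
          rw [Finset.mul_sum]
          exact Finset.sum_congr rfl fun a _ => by ring
      _ ≤ C ^ 2 * (∑ a, w a * (C ^ k * ∑ x : Fin k → X, (∏ l, w (x l)) *
            ‖tensorApply T G (Fin.cons a x)‖ ^ 2)) ^ 2 := by
          refine mul_le_mul_of_nonneg_left ?_ (sq_nonneg C)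
          refine sum_weighted_sq_sum_le hw hw' _ (fun a => mul_nonneg (pow_nonneg hC k)
            (Finset.sum_nonneg fun x _ => mul_nonneg (hw' x) (sq_nonneg _))) fun a => ?_
          simp only [← pow_mul, tensorApply_cons']
          exact tensorApply_fourth_moment hw hC hT k _
      _ = _ := by
          rw [← mul_pow, Finset.mul_sum, Finset.mul_sum]
          congr 1
          refine Finset.sum_congr rfl fun a _ => ?_
          simp only [Finset.mul_sum]
          exact Finset.sum_congr rfl fun x _ => by ring

/-- The interpolation `‖f‖₂³ ≤ ‖f‖₁ ‖f‖₄²` in weighted `L^p`. -/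
theorem second_moment_cube_le {Y : Type*} [Fintype Y] {w f : Y → ℝ} (hw : ∀ y, 0 ≤ w y)
    (hf : ∀ y, 0 ≤ f y) :
    (∑ y, w y * f y ^ 2) ^ 3 ≤ (∑ y, w y * f y) ^ 2 * ∑ y, w y * f y ^ 4 := by
  have cs : ∀ p q r : ℕ, p + q = 2 * r →
      (∑ y, w y * f y ^ r) ^ 2 ≤ (∑ y, w y * f y ^ p) * ∑ y, w y * f y ^ q := by
    intro p q r h
    refine Finset.sum_sq_le_sum_mul_sum_of_sq_le_mul _ (fun y _ => mul_nonneg (hw y)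
      (pow_nonneg (hf y) _)) (fun y _ => mul_nonneg (hw y) (pow_nonneg (hf y) _)) fun y _ => ?_
    rw [mul_pow, ← pow_mul, mul_comm r 2, ← h, pow_add]
    exact le_of_eq (by ring)
  have h1 := cs 1 3 2 rfl
  have h2 := cs 2 4 3 rfl
  simp only [pow_one] at h1
  set A := ∑ y, w y * f y
  set B := ∑ y, w y * f y ^ 2
  set D := ∑ y, w y * f y ^ 3
  set E := ∑ y, w y * f y ^ 4
  have hA : 0 ≤ A := Finset.sum_nonneg fun y _ => mul_nonneg (hw y) (hf y)
  have hB : 0 ≤ B := Finset.sum_nonneg fun y _ => mul_nonneg (hw y) (pow_nonneg (hf y) _)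
  have hE : 0 ≤ E := Finset.sum_nonneg fun y _ => mul_nonneg (hw y) (pow_nonneg (hf y) _)
  rcases hB.eq_or_lt with h0 | h0
  · rw [← h0, zero_pow three_ne_zero]; positivity
  -- The third moment `D` is eliminated between the two Cauchy–Schwarz bounds `B² ≤ A D` and `D² ≤ B
  -- E`; one factor `B` then cancels.
  have h3 : B * B ^ 3 ≤ B * (A ^ 2 * E) := by
    calc B * B ^ 3 = (B ^ 2) ^ 2 := by ring
      _ ≤ (A * D) ^ 2 := pow_le_pow_left₀ (sq_nonneg _) h1 2
      _ = A ^ 2 * D ^ 2 := by ring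
      _ ≤ A ^ 2 * (B * E) := mul_le_mul_of_nonneg_left h2 (sq_nonneg _)
      _ = _ := by ring
  exact le_of_mul_le_mul_left h3 h0

/-- A linear map whose image satisfies an `L⁴`–`L²` inequality and which does not decrease the
`ℓ²`-norm satisfies, on every tensor power, an `ℓ²`–`L¹` lower bound. -/
theorem sum_norm_sq_le_sq_tensorApply [Fintype X] {T : X → J → ℂ} {w : X → ℝ} (hw : ∀ x, 0 ≤ w x) {C : ℝ}
    (hC : 0 ≤ C)
    (hT2 : ∀ η : J → ℂ, ∑ j, ‖η j‖ ^ 2 ≤ ∑ x, w x * ‖∑ j, T x j * η j‖ ^ 2)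
    (hT4 : ∀ η : J → ℂ, ∑ x, w x * ‖∑ j, T x j * η j‖ ^ 4
      ≤ C ^ 2 * (∑ x, w x * ‖∑ j, T x j * η j‖ ^ 2) ^ 2) (k : ℕ) (G : (Fin k → J) → ℂ) :
    ∑ j, ‖G j‖ ^ 2
      ≤ (C ^ k * ∑ x : Fin k → X, (∏ l, w (x l)) * ‖tensorApply T G x‖) ^ 2 := by
  have hw' : ∀ x : Fin k → X, 0 ≤ ∏ l, w (x l) := fun x => Finset.prod_nonneg fun l _ => hw _
  have h4 := tensorApply_fourth_moment hw hC hT4 k G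
  have h3 := second_moment_cube_le hw' fun x => norm_nonneg (tensorApply T G x)
  refine (sum_norm_sq_le_tensorApply hw hT2 k G).trans ?_
  set A := ∑ x : Fin k → X, (∏ l, w (x l)) * ‖tensorApply T G x‖
  set B := ∑ x : Fin k → X, (∏ l, w (x l)) * ‖tensorApply T G x‖ ^ 2
  have hB : 0 ≤ B := Finset.sum_nonneg fun x _ => mul_nonneg (hw' x) (sq_nonneg _)
  rcases hB.eq_or_lt with h0 | h0
  · rw [← h0]; positivity
  refine le_of_mul_le_mul_left ?_ (pow_pos h0 2)
  calc B ^ 2 * B = B ^ 3 := by ring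
    _ ≤ A ^ 2 * (C ^ k * B) ^ 2 := h3.trans (mul_le_mul_of_nonneg_left h4 (sq_nonneg _))
    _ = _ := by ring

end TensorPowers

/-! ### Random vectors with the moments of a complex Gaussian vector -/

/-- The moments of bidegree `(k, k)` of the random vector `v` with the weights `w` are those of a
standard complex Gaussian vector. -/
def HasGaussianMoments {X : Type*} [Fintype X] {d : ℕ} (w : X → ℝ) (v : X → Fin d → ℂ)
    (k : ℕ) : Prop :=
  ∀ a b : Fin k → Fin d,
    ∑ x, (w x : ℂ) * ∏ l, (v x (b l) * star (v x (a l)))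
      = (Finset.univ.filter fun σ : Equiv.Perm (Fin k) => b = a ∘ σ).card

/-- Wick's formula for linear forms: by multilinearity it follows from the monomial moments, and the
right side is the permanent of the matrix of pairings of the `f` with the `g`. -/
theorem HasGaussianMoments.sum_prod_form {X : Type*} [Fintype X] {d k : ℕ} {w : X → ℝ}
    {v : X → Fin d → ℂ} (h : HasGaussianMoments w v k) (f g : Fin k → Fin d → ℂ) :
    ∑ x, (w x : ℂ) * ∏ l, ((∑ j, f l j * v x j) * star (∑ j, g l j * v x j))
      = ∑ σ : Equiv.Perm (Fin k), ∏ l, ∑ j, f (σ l) j * star (g l j) := by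
  have e : ∀ x, ∏ l, ((∑ j, f l j * v x j) * star (∑ j, g l j * v x j))
      = ∑ b : Fin k → Fin d, ∑ a : Fin k → Fin d,
          (∏ l, f l (b l)) * (∏ l, star (g l (a l))) * ∏ l, (v x (b l) * star (v x (a l))) := by
    intro x
    simp only [Finset.prod_mul_distrib, star_sum, star_mul', Finset.prod_univ_sum,
      Fintype.piFinset_univ, Finset.sum_mul_sum]
    exact Finset.sum_congr rfl fun b _ => Finset.sum_congr rfl fun a _ => by ring
  calc _ = ∑ b : Fin k → Fin d, ∑ a : Fin k → Fin d, (∏ l, f l (b l)) *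
        (∏ l, star (g l (a l))) * ∑ x, (w x : ℂ) * ∏ l, (v x (b l) * star (v x (a l))) := by
        simp only [e, Finset.mul_sum]
        rw [Finset.sum_comm]
        refine Finset.sum_congr rfl fun b _ => ?_
        rw [Finset.sum_comm]
        exact Finset.sum_congr rfl fun a _ => Finset.sum_congr rfl fun x _ => by ring
    _ = ∑ b : Fin k → Fin d, ∑ a : Fin k → Fin d, ∑ σ : Equiv.Perm (Fin k),
          if b = a ∘ σ then (∏ l, f l (b l)) * ∏ l, star (g l (a l)) else 0 := by
        refine Finset.sum_congr rfl fun b _ => Finset.sum_congr rfl fun a _ => ?_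
        rw [h a b, Finset.card_filter, Nat.cast_sum, Finset.mul_sum]
        exact Finset.sum_congr rfl fun σ _ => by split_ifs <;> simp
    _ = ∑ σ : Equiv.Perm (Fin k), ∑ a : Fin k → Fin d,
          (∏ l, f l (a (σ l))) * ∏ l, star (g l (a l)) := by
        rw [Finset.sum_comm, Finset.sum_congr rfl fun a _ => Finset.sum_comm, Finset.sum_comm]
        refine Finset.sum_congr rfl fun σ _ => Finset.sum_congr rfl fun a _ => ?_
        rw [Finset.sum_ite_eq' Finset.univ (a ∘ σ)]
        simp
    _ = ∑ σ : Equiv.Perm (Fin k), ∏ l, ∑ j, f (σ⁻¹ l) j * star (g l j) := by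
        refine Finset.sum_congr rfl fun σ _ => ?_
        rw [Finset.prod_univ_sum, Fintype.piFinset_univ]
        refine Finset.sum_congr rfl fun a _ => ?_
        rw [Finset.prod_mul_distrib]
        congr 1
        rw [← Equiv.prod_comp σ fun l => f (σ⁻¹ l) (a l)]
        simp
    _ = _ := Equiv.sum_comp (Equiv.inv (Equiv.Perm (Fin k)))
        fun σ : Equiv.Perm (Fin k) => ∏ l, ∑ j, f (σ l) j * star (g l j)

/-- `tr (v v* ξ)`. -/
noncomputable def rankOneForm {d : ℕ} (v : Fin d → ℂ) (ξ : Matrix (Fin d) (Fin d) ℂ) : ℂ :=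
  ∑ j : Fin d × Fin d, v j.1 * star (v j.2) * ξ j.2 j.1

theorem rankOneForm_eq_sum_eigenvalues {d : ℕ} (v : Fin d → ℂ) {ξ : Matrix (Fin d) (Fin d) ℂ}
    (hξ : ξ.IsHermitian) :
    rankOneForm v ξ = ∑ i, (hξ.eigenvalues i : ℂ) *
      ((∑ j, star ((hξ.eigenvectorUnitary : Matrix _ _ ℂ) j i) * v j) *
        star (∑ j, star ((hξ.eigenvectorUnitary : Matrix _ _ ℂ) j i) * v j)) := by
  have e : ∀ b a, ξ b a = ∑ i, (hξ.eigenvectorUnitary : Matrix _ _ ℂ) b i *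
      (hξ.eigenvalues i : ℂ) * star ((hξ.eigenvectorUnitary : Matrix _ _ ℂ) a i) := by
    intro b a
    conv_lhs => rw [hξ.spectral_theorem, Unitary.conjStarAlgAut_apply]
    simp [Matrix.mul_apply, Matrix.diagonal_apply, Matrix.star_apply]
  rw [rankOneForm, Fintype.sum_prod_type]
  simp only [e, star_sum, star_mul', star_star, Finset.mul_sum, Finset.sum_mul]
  rw [Finset.sum_congr rfl fun a _ => Finset.sum_comm, Finset.sum_comm]
  refine Finset.sum_congr rfl fun i _ => ?_
  rw [Finset.sum_comm]
  exact Finset.sum_congr rfl fun b _ => Finset.sum_congr rfl fun a _ => by ring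

/-- The moments of the quadratic form of a Hermitian matrix only depend on its eigenvalues. -/
theorem HasGaussianMoments.sum_rankOneForm_pow {X : Type*} [Fintype X] {d k : ℕ} {w : X → ℝ}
    {v : X → Fin d → ℂ} (h : HasGaussianMoments w v k) {ξ : Matrix (Fin d) (Fin d) ℂ}
    (hξ : ξ.IsHermitian) :
    ∑ x, (w x : ℂ) * rankOneForm (v x) ξ ^ k
      = ∑ i : Fin k → Fin d, (∏ l, (hξ.eigenvalues (i l) : ℂ)) *
          (Finset.univ.filter fun σ : Equiv.Perm (Fin k) => i = i ∘ σ).card := by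
  set U : Matrix (Fin d) (Fin d) ℂ := hξ.eigenvectorUnitary.1 with hU
  have hUU : ∀ i i', ∑ j, star (U j i) * U j i' = if i = i' then 1 else 0 := by
    intro i i'
    have := congrFun (congrFun (Unitary.coe_star_mul_self hξ.eigenvectorUnitary) i) i'
    rw [Matrix.mul_apply, Matrix.one_apply] at this
    exact this
  simp only [rankOneForm_eq_sum_eigenvalues _ hξ, ← hU, Fintype.sum_pow, Finset.mul_sum]
  rw [Finset.sum_comm]
  refine Finset.sum_congr rfl fun i _ => ?_
  have := h.sum_prod_form (fun l j => star (U j (i l))) (fun l j => star (U j (i l)))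
  simp only [star_star, hUU] at this
  rw [Finset.card_filter, Nat.cast_sum]
  have e : ∀ σ : Equiv.Perm (Fin k), (((if i = i ∘ σ then 1 else 0 : ℕ)) : ℂ)
      = ∏ l, if i (σ l) = i l then 1 else 0 := by
    intro σ
    rw [Finset.prod_ite_zero]
    simp [funext_iff, eq_comm]
  rw [Finset.sum_congr rfl fun σ _ => e σ, ← this, Finset.mul_sum]
  refine Finset.sum_congr rfl fun x _ => ?_
  rw [Finset.prod_mul_distrib]
  ring

/-! ### Independent coordinates -/

/-- The solutions `σ` are either absent or a coset of the stabilizer of `a`, and they exist exactly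
when `a` and `b` have fibres of equal sizes. The product form is what makes Gaussian moments factor
over independent coordinates. -/
theorem card_perm_eq_comp {α β : Type*} [Fintype α] [DecidableEq α] [Fintype β] [DecidableEq β]
    (a b : α → β) :
    (Finset.univ.filter fun σ : Equiv.Perm α => b = a ∘ σ).card
      = ∏ i, if Fintype.card {l // b l = i} = Fintype.card {l // a l = i}
          then (Fintype.card {l // a l = i}).factorial else 0 := by
  rw [Finset.prod_ite_zero]
  split_ifs with h
  · obtain ⟨τ, hτ⟩ : ∃ τ : Equiv.Perm α, b = a ∘ τ := by
      have e : ∀ i, Nonempty ({l // b l = i} ≃ {l // a l = i}) := fun i =>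
        ⟨Fintype.equivOfCardEq (h i (Finset.mem_univ i))⟩
      exact ⟨Equiv.ofFiberEquiv fun i => (e i).some, funext fun l =>
        (Equiv.ofFiberEquiv_map (fun i => (e i).some) l).symm⟩
    rw [← DomMulAct.stabilizer_card a, Fintype.card_subtype]
    refine Finset.card_bij (fun σ _ => σ * τ⁻¹) ?_ ?_ ?_
    · intro σ hσ
      simp only [Finset.mem_filter, Finset.mem_univ, true_and] at hσ ⊢
      funext l
      have := congrFun (hτ.symm.trans hσ) (τ⁻¹ l)
      simpa using this.symm
    · intro σ _ σ' _ h
      exact mul_right_cancel h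
    · intro σ hσ
      simp only [Finset.mem_filter, Finset.mem_univ, true_and] at hσ ⊢
      refine ⟨σ * τ, ?_, by simp⟩
      rw [hτ, Equiv.Perm.coe_mul, ← Function.comp_assoc, hσ]
  · rw [Finset.card_eq_zero, Finset.filter_eq_empty_iff]
    intro σ _ hσ
    refine h fun i _ => Fintype.card_congr ?_
    subst hσ
    exact σ.subtypeEquiv fun l => Iff.rfl

theorem prod_apply_comp {α β : Type*} [Fintype α] [Fintype β] [DecidableEq β] {R : Type*}
    [CommMonoid R] (b : α → β) (f : β → R) :
    ∏ l, f (b l) = ∏ i, f i ^ Fintype.card {l // b l = i} := by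
  classical
  rw [← Finset.prod_fiberwise Finset.univ b fun l => f (b l)]
  refine Finset.prod_congr rfl fun i _ => ?_
  rw [Fintype.card_subtype, ← Finset.prod_const]
  refine Finset.prod_congr rfl fun l hl => ?_
  rw [(Finset.mem_filter.mp hl).2]

/-- Independent coordinates with Gaussian moments form a vector with Gaussian moments. -/
theorem hasGaussianMoments_pi {Y : Type*} [Fintype Y] {q : Y → ℝ} {c : Y → ℂ} {K : ℕ}
    (h : ∀ m ≤ K, ∀ n ≤ K, ∑ y, (q y : ℂ) * (c y ^ m * star (c y) ^ n)
      = if m = n then (n.factorial : ℂ) else 0) (d : ℕ) {k : ℕ} (hk : k ≤ K) :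
    HasGaussianMoments (fun x : Fin d → Y => ∏ i, q (x i)) (fun x i => c (x i)) k := by
  intro a b
  rw [card_perm_eq_comp, Nat.cast_prod]
  have hle : ∀ (e : Fin k → Fin d) i, Fintype.card {l // e l = i} ≤ K := fun e i =>
    ((Fintype.card_subtype_le _).trans (Fintype.card_fin k).le).trans hk
  have e : ∀ x : Fin d → Y, ((∏ i, q (x i) : ℝ) : ℂ) * ∏ l, (c (x (b l)) * star (c (x (a l))))
      = ∏ i, (q (x i) : ℂ) * (c (x i) ^ Fintype.card {l // b l = i} *
          star (c (x i)) ^ Fintype.card {l // a l = i}) := by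
    intro x
    rw [Finset.prod_mul_distrib, Finset.prod_mul_distrib, Finset.prod_mul_distrib,
      prod_apply_comp b fun i => c (x i), prod_apply_comp a fun i => star (c (x i)),
      Complex.ofReal_prod]
  rw [Finset.sum_congr rfl fun x _ => e x]
  have := (Finset.prod_univ_sum (fun _ : Fin d => (Finset.univ : Finset Y)) fun i y =>
    (q y : ℂ) * (c y ^ Fintype.card {l // b l = i} * star (c y) ^ Fintype.card {l // a l = i}))
  rw [Fintype.piFinset_univ] at this
  rw [← this]
  refine Finset.prod_congr rfl fun i _ => ?_
  rw [h _ (hle b i) _ (hle a i)]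
  split_ifs <;> simp

/-- The first moments of a linear combination of independent centred variables with the moments
`1, 0, 1, ·, 9` of a centred exponential variable. -/
theorem moments_sum_independent {Y : Type*} [Fintype Y] {q e : Y → ℝ} (hq : ∑ y, q y = 1)
    (h1 : ∑ y, q y * e y = 0) (h2 : ∑ y, q y * e y ^ 2 = 1) (h4 : ∑ y, q y * e y ^ 4 = 9) :
    ∀ (d : ℕ) (c : Fin d → ℝ),
      (∑ x : Fin d → Y, ∏ i, q (x i) = 1) ∧
      (∑ x : Fin d → Y, (∏ i, q (x i)) * ∑ i, c i * e (x i) = 0) ∧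
      (∑ x : Fin d → Y, (∏ i, q (x i)) * (∑ i, c i * e (x i)) ^ 2 = ∑ i, c i ^ 2) ∧
      (∑ x : Fin d → Y, (∏ i, q (x i)) * (∑ i, c i * e (x i)) ^ 4 ≤ 9 * (∑ i, c i ^ 2) ^ 2)
  | 0, c => by simp
  | d + 1, c => by
    obtain ⟨i0, i1, i2, i4⟩ := moments_sum_independent hq h1 h2 h4 d fun i => c i.succ
    simp only [sum_fin_succ_pi, Fin.prod_univ_succ, Fin.sum_univ_succ, Fin.cons_zero, Fin.cons_succ]
    set p : (Fin d → Y) → ℝ := fun x => ∏ i, q (x i)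
    set Z : (Fin d → Y) → ℝ := fun x => ∑ i : Fin d, c i.succ * e (x i)
    have expand : ∀ (F : Y → ℝ) (G : (Fin d → Y) → ℝ),
        ∑ y, ∑ x, (q y * F y) * (p x * G x) = (∑ y, q y * F y) * ∑ x, p x * G x := by
      intro F G
      rw [Finset.sum_mul_sum]
    have hq' : ∑ y, q y * (fun _ => (1 : ℝ)) y = 1 := by simpa using hq
    have i0' : ∑ x, p x * (fun _ => (1 : ℝ)) x = 1 := by simpa using i0
    change _ = 0 at i1
    refine ⟨?_, ?_, ?_, ?_⟩
    · have := expand (fun _ => 1) (fun _ => 1)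
      rw [hq', i0'] at this
      simpa using this
    · calc _ = c 0 * (∑ y, ∑ x, (q y * e y) * (p x * 1))
            + ∑ y, ∑ x, (q y * 1) * (p x * Z x) := by
            simp only [Finset.mul_sum, ← Finset.sum_add_distrib]
            exact Finset.sum_congr rfl fun y _ => Finset.sum_congr rfl fun x _ => by
              simp only [p, Z]; ring
        _ = 0 := by
            rw [expand e fun _ => 1, expand (fun _ => 1) Z, h1, i1]; ring
    · calc _ = c 0 ^ 2 * (∑ y, ∑ x, (q y * e y ^ 2) * (p x * 1))
            + 2 * c 0 * (∑ y, ∑ x, (q y * e y) * (p x * Z x))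
            + ∑ y, ∑ x, (q y * 1) * (p x * Z x ^ 2) := by
            simp only [Finset.mul_sum, ← Finset.sum_add_distrib]
            exact Finset.sum_congr rfl fun y _ => Finset.sum_congr rfl fun x _ => by
              simp only [p, Z]; ring
        _ = _ := by
            rw [expand (fun y => e y ^ 2) fun _ => 1, expand e Z,
              expand (fun _ => 1) (fun x => Z x ^ 2), h1, h2, hq', i2, i0']; ring
    · calc _ = c 0 ^ 4 * (∑ y, ∑ x, (q y * e y ^ 4) * (p x * 1))
            + 4 * c 0 ^ 3 * (∑ y, ∑ x, (q y * e y ^ 3) * (p x * Z x))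
            + 6 * c 0 ^ 2 * (∑ y, ∑ x, (q y * e y ^ 2) * (p x * Z x ^ 2))
            + 4 * c 0 * (∑ y, ∑ x, (q y * e y) * (p x * Z x ^ 3))
            + ∑ y, ∑ x, (q y * 1) * (p x * Z x ^ 4) := by
            simp only [Finset.mul_sum, ← Finset.sum_add_distrib]
            exact Finset.sum_congr rfl fun y _ => Finset.sum_congr rfl fun x _ => by
              simp only [p, Z]; ring
        -- The third moments of `e` and of `Z` drop out because each is multiplied by a vanishing
        -- mean.
        _ = 9 * c 0 ^ 4 + 6 * c 0 ^ 2 * (∑ i : Fin d, c i.succ ^ 2) + ∑ x, p x * Z x ^ 4 := by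
            rw [expand (fun y => e y ^ 4) fun _ => 1, expand (fun y => e y ^ 3) Z,
              expand (fun y => e y ^ 2) (fun x => Z x ^ 2), expand e (fun x => Z x ^ 3),
              expand (fun _ => 1) (fun x => Z x ^ 4), h1, h2, h4, hq', i1, i2, i0']; ring
        _ ≤ _ := by
            have : 0 ≤ c 0 ^ 2 * ∑ i : Fin d, c i.succ ^ 2 := by positivity
            change ∑ x, p x * Z x ^ 4 ≤ _ at i4
            nlinarith

/-- A finitely supported law on `ℂ` with the moments `𝔼 z^m z̄^n = δ_{mn} n!` for `m, n ≤ 4`. -/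
theorem exists_law_gaussian_moments :
    ∃ (q : Fin 3 × Fin 5 → ℝ) (c : Fin 3 × Fin 5 → ℂ), (∀ y, 0 ≤ q y) ∧
      ∀ m ≤ 4, ∀ n ≤ 4, ∑ y, (q y : ℂ) * (c y ^ m * star (c y) ^ n)
        = if m = n then (n.factorial : ℂ) else 0 := by
  have h3 : Real.sqrt 3 ^ 2 = 3 := Real.sq_sqrt (by norm_num)
  have h3l : Real.sqrt 3 ≤ 2 := by nlinarith [Real.sqrt_nonneg 3]
  set s := Real.sqrt 3
  -- For a complex Gaussian, `|z|²` is exponentially distributed. These are the nodes and weights of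
  -- the three-point Gauss–Radau rule with node 0 for `e^{-r}` on the half-line, exact up to degree
  -- 4; the modulus of `z` is `√r`.
  let r : Fin 3 → ℝ := ![0, 3 - s, 3 + s]
  let p : Fin 3 → ℝ := ![1 / 3, (2 + s) / 6, (2 - s) / 6]
  have hr : ∀ t, 0 ≤ r t := by
    intro t
    fin_cases t
    · simp [r]
    · simp only [r]; change 0 ≤ 3 - s; linarith
    · simp only [r]; change 0 ≤ 3 + s; linarith [Real.sqrt_nonneg 3]
  have hp : ∀ t, 0 ≤ p t := by
    intro t
    fin_cases t
    · simp [p]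
    · simp only [p]; change 0 ≤ (2 + s) / 6; linarith [Real.sqrt_nonneg 3]
    · simp only [p]; change 0 ≤ (2 - s) / 6; linarith
  have hs4 : s ^ 4 = 9 := by rw [show s ^ 4 = (s ^ 2) ^ 2 by ring, h3]; norm_num
  have hm : ∀ n ≤ 4, ∑ t, p t * r t ^ n = n.factorial := by
    intro n hn
    simp only [Fin.sum_univ_three]
    change 1 / 3 * 0 ^ n + (2 + s) / 6 * (3 - s) ^ n + (2 - s) / 6 * (3 + s) ^ n = _
    interval_cases n <;> norm_num [Nat.factorial] <;> ring_nf <;> norm_num [h3, hs4]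
  -- Uniform fifth roots of unity as phases kill `z^m z̄^n` unless `m ≡ n` mod 5, which for `m, n ≤
  -- 4` means `m = n`.
  let ω : ℂ := Complex.exp (2 * Real.pi * Complex.I / 5)
  have hω : IsPrimitiveRoot ω 5 := by
    simpa [ω] using Complex.isPrimitiveRoot_exp 5 (by norm_num)
  have hω' : star ω = ω ^ 4 := by
    have h1 : ω * star ω = 1 := by
      have : ‖ω‖ = 1 := hω.norm'_eq_one (by norm_num)
      rw [Complex.star_def, Complex.mul_conj, Complex.normSq_eq_norm_sq, this]; norm_num
    have h5 : ω * ω ^ 4 = 1 := by rw [← pow_succ']; exact hω.pow_eq_one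
    exact mul_left_cancel₀ (hω.ne_zero (by norm_num)) (h1.trans h5.symm)
  refine ⟨fun y => p y.1 / 5, fun y => (Real.sqrt (r y.1) : ℂ) * ω ^ (y.2 : ℕ),
    fun y => div_nonneg (hp _) (by norm_num), ?_⟩
  intro m hm4 n hn4
  have e : ∀ y : Fin 3 × Fin 5, ((p y.1 / 5 : ℝ) : ℂ) * (((Real.sqrt (r y.1) : ℂ) * ω ^ (y.2 : ℕ)) ^ m *
      star ((Real.sqrt (r y.1) : ℂ) * ω ^ (y.2 : ℕ)) ^ n)
      = ((p y.1 / 5 : ℝ) * (Real.sqrt (r y.1) : ℂ) ^ (m + n)) * (ω ^ (m + 4 * n)) ^ (y.2 : ℕ) := by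
    intro y
    rw [star_mul', star_pow, hω', Complex.star_def, Complex.conj_ofReal]
    ring
  simp only [e, Fintype.sum_prod_type, ← Finset.mul_sum]
  rw [← Finset.sum_mul, Fin.sum_univ_eq_sum_range (fun j => (ω ^ (m + 4 * n)) ^ j)]
  split_ifs with hmn
  · subst hmn
    have h1 : ω ^ (m + 4 * m) = 1 := by
      rw [show m + 4 * m = 5 * m by ring, pow_mul, hω.pow_eq_one, one_pow]
    rw [h1]
    simp only [one_pow, Finset.sum_const, Finset.card_range, nsmul_eq_mul, mul_one, Finset.sum_mul]
    have := congrArg (fun z : ℝ => (z : ℂ)) (hm m hm4)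
    simp only [Complex.ofReal_sum, Complex.ofReal_natCast] at this
    rw [← this]
    refine Finset.sum_congr rfl fun t _ => ?_
    rw [← two_mul, pow_mul, ← Complex.ofReal_pow, Real.sq_sqrt (hr t)]
    push_cast
    ring
  · have h1 : ω ^ (m + 4 * n) ≠ 1 := by
      rw [Ne, hω.pow_eq_one_iff_dvd]
      omega
    have h2 : ∑ j ∈ Finset.range 5, (ω ^ (m + 4 * n)) ^ j = 0 := by
      have := mul_geom_sum (ω ^ (m + 4 * n)) 5
      rw [← pow_mul, mul_comm (m + 4 * n) 5, pow_mul, hω.pow_eq_one, one_pow, sub_self] at this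
      exact (mul_eq_zero.mp this).resolve_left (sub_ne_zero.mpr h1)
    rw [h2, mul_zero]

/-! ### Second and fourth moments of quadratic forms -/

theorem HasGaussianMoments.sum_diagonal_pow {X : Type*} [Fintype X] {d k : ℕ} {w : X → ℝ}
    {v : X → Fin d → ℂ} (h : HasGaussianMoments w v k) (c : Fin d → ℝ) :
    ∑ x, (w x : ℂ) * (∑ i, (c i : ℂ) * (v x i * star (v x i))) ^ k
      = ∑ i : Fin k → Fin d, (∏ l, (c (i l) : ℂ)) *
          (Finset.univ.filter fun σ : Equiv.Perm (Fin k) => i = i ∘ σ).card := by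
  simp only [Fintype.sum_pow, Finset.mul_sum]
  rw [Finset.sum_comm]
  refine Finset.sum_congr rfl fun i _ => ?_
  rw [← h i i, Finset.mul_sum]
  refine Finset.sum_congr rfl fun x _ => ?_
  rw [Finset.prod_mul_distrib]
  ring

/-- Since the moments of a Hermitian form depend only on its eigenvalues `c`, it suffices to study
the diagonal model `∑ c_i |z_i|²` with independent `z_i`. There it is a sum of independent
variables. -/
theorem exists_moments_eq_sq_add {d : ℕ} (c : Fin d → ℝ) :
    ∃ m : ℕ → ℝ, m 4 ≤ 18 * m 2 ^ 2 ∧ ∀ k ≤ 4,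
      ((m k : ℝ) : ℂ) = ∑ i : Fin k → Fin d, (∏ l, (c (i l) : ℂ)) *
        (Finset.univ.filter fun σ : Equiv.Perm (Fin k) => i = i ∘ σ).card := by
  obtain ⟨q, z, hq, hz⟩ := exists_law_gaussian_moments
  have hr : ∀ m ≤ 4, ∑ y, q y * Complex.normSq (z y) ^ m = m.factorial := by
    intro m hm
    have := hz m hm m hm
    rw [if_pos rfl] at this
    apply Complex.ofReal_injective
    push_cast
    rw [← this]
    refine Finset.sum_congr rfl fun y _ => ?_
    rw [← mul_pow, Complex.star_def, Complex.mul_conj]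
  have r0 := hr 0 (by norm_num)
  have r1 := hr 1 (by norm_num)
  have r2 := hr 2 (by norm_num)
  have r3 := hr 3 (by norm_num)
  have r4 := hr 4 (by norm_num)
  norm_num [Nat.factorial] at r0 r1 r2 r3 r4
  set e : Fin 3 × Fin 5 → ℝ := fun y => Complex.normSq (z y) - 1
  have e1 : ∑ y, q y * e y = 0 := by
    simp only [e, mul_sub, mul_one, Finset.sum_sub_distrib, r0, r1, sub_self]
  have e2 : ∑ y, q y * e y ^ 2 = 1 := by
    calc _ = ∑ y, q y * Complex.normSq (z y) ^ 2 - 2 * ∑ y, q y * Complex.normSq (z y)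
          + ∑ y, q y := by
          rw [Finset.mul_sum, ← Finset.sum_sub_distrib, ← Finset.sum_add_distrib]
          exact Finset.sum_congr rfl fun y _ => by simp only [e]; ring
      _ = 1 := by rw [r0, r1, r2]; norm_num
  have e4 : ∑ y, q y * e y ^ 4 = 9 := by
    calc _ = ∑ y, q y * Complex.normSq (z y) ^ 4 - 4 * ∑ y, q y * Complex.normSq (z y) ^ 3
          + 6 * ∑ y, q y * Complex.normSq (z y) ^ 2 - 4 * ∑ y, q y * Complex.normSq (z y)
          + ∑ y, q y := by
          rw [Finset.mul_sum, Finset.mul_sum, Finset.mul_sum, ← Finset.sum_sub_distrib,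
            ← Finset.sum_add_distrib, ← Finset.sum_sub_distrib, ← Finset.sum_add_distrib]
          exact Finset.sum_congr rfl fun y _ => by simp only [e]; ring
      _ = 9 := by rw [r0, r1, r2, r3, r4]; norm_num
  obtain ⟨m0, m1, m2, m4⟩ := moments_sum_independent r0 e1 e2 e4 d c
  set W : (Fin d → Fin 3 × Fin 5) → ℝ := fun x => ∏ i, q (x i)
  set Z : (Fin d → Fin 3 × Fin 5) → ℝ := fun x => ∑ i, c i * e (x i)
  have hW : ∀ x, 0 ≤ W x := fun x => Finset.prod_nonneg fun i _ => hq _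
  change ∑ x, W x = 1 at m0
  change ∑ x, W x * Z x = 0 at m1
  change ∑ x, W x * Z x ^ 2 = _ at m2
  change ∑ x, W x * Z x ^ 4 ≤ _ at m4
  set a := ∑ i, c i
  set b := ∑ i, c i ^ 2
  have hb : 0 ≤ b := Finset.sum_nonneg fun i _ => sq_nonneg _
  -- `a + Z` is `∑ c_i |z_i|²`, split into its mean `a = ∑ c_i` and the centred part `Z`.
  refine ⟨fun k => ∑ x, W x * (a + Z x) ^ k, ?_, ?_⟩
  · have h2 : ∑ x, W x * (a + Z x) ^ 2 = a ^ 2 + b := by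
      calc _ = a ^ 2 * ∑ x, W x + 2 * a * ∑ x, W x * Z x + ∑ x, W x * Z x ^ 2 := by
            simp only [Finset.mul_sum, ← Finset.sum_add_distrib]
            exact Finset.sum_congr rfl fun y _ => by ring
        _ = _ := by rw [m0, m1, m2]; ring
    have h4 : ∑ x, W x * (a + Z x) ^ 4 ≤ a ^ 4 + 10 * a ^ 2 * b + 2 * (9 * b ^ 2) := by
      calc _ ≤ ∑ x, W x * (a ^ 4 + 4 * a ^ 3 * Z x + 10 * a ^ 2 * Z x ^ 2 + 2 * Z x ^ 4) := by
            refine Finset.sum_le_sum fun x _ => mul_le_mul_of_nonneg_left ?_ (hW x)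
            -- The right side minus `(a + Z)^4` is `Z² (2a - Z)²`; this trades the cubic term in
            -- `Z`, whose mean is not controlled, for even ones.
            nlinarith [sq_nonneg (Z x * (2 * a - Z x)), sq_nonneg (Z x * (a - Z x)),
              sq_nonneg (Z x * a), sq_nonneg (Z x * Z x)]
        _ = a ^ 4 * ∑ x, W x + 4 * a ^ 3 * ∑ x, W x * Z x + 10 * a ^ 2 * ∑ x, W x * Z x ^ 2
            + 2 * ∑ x, W x * Z x ^ 4 := by
            simp only [Finset.mul_sum, ← Finset.sum_add_distrib]
            exact Finset.sum_congr rfl fun y _ => by ring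
        _ ≤ _ := by rw [m0, m1, m2]; linarith
    simp only [h2]
    refine h4.trans ?_
    nlinarith [mul_nonneg (sq_nonneg a) hb, sq_nonneg (a ^ 2)]
  · intro k hk
    rw [← (hasGaussianMoments_pi hz d hk).sum_diagonal_pow c]
    push_cast
    refine Finset.sum_congr rfl fun x _ => ?_
    congr 2
    · exact Complex.ofReal_prod _ _
    · simp only [Complex.star_def, Complex.mul_conj, Z, a, e]
      push_cast
      rw [← Finset.sum_add_distrib]
      exact Finset.sum_congr rfl fun i _ => by ring

/-- The quadratic form of a Hermitian matrix is real. -/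
theorem rankOneForm_re {d : ℕ} (v : Fin d → ℂ) {ξ : Matrix (Fin d) (Fin d) ℂ}
    (hξ : ξ.IsHermitian) : rankOneForm v ξ = ((rankOneForm v ξ).re : ℂ) := by
  rw [eq_comm, ← Complex.conj_eq_iff_re, rankOneForm, map_sum]
  rw [← (Equiv.prodComm (Fin d) (Fin d)).sum_comp]
  refine Finset.sum_congr rfl fun j _ => ?_
  have := hξ.apply j.1 j.2
  simp only [Equiv.prodComm_apply, Prod.fst_swap, Prod.snd_swap, map_mul, Complex.star_def,
    Complex.conj_conj] at this ⊢
  rw [← this]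
  simp only [Complex.conj_conj]
  ring

theorem HasGaussianMoments.fourth_moment_le_of_isHermitian {X : Type*} [Fintype X] {d : ℕ}
    {w : X → ℝ} {v : X → Fin d → ℂ} (h2 : HasGaussianMoments w v 2)
    (h4 : HasGaussianMoments w v 4) {ξ : Matrix (Fin d) (Fin d) ℂ} (hξ : ξ.IsHermitian) :
    ∑ x, w x * (rankOneForm (v x) ξ).re ^ 4
      ≤ 18 * (∑ x, w x * (rankOneForm (v x) ξ).re ^ 2) ^ 2 := by
  obtain ⟨m, hm, hk⟩ := exists_moments_eq_sq_add hξ.eigenvalues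
  have key : ∀ k ≤ 4, HasGaussianMoments w v k →
      ∑ x, w x * (rankOneForm (v x) ξ).re ^ k = m k := by
    intro k hk4 h
    apply Complex.ofReal_injective
    rw [hk k hk4, ← h.sum_rankOneForm_pow hξ]
    push_cast
    exact Finset.sum_congr rfl fun x _ => by rw [← rankOneForm_re _ hξ]
  rw [key 4 le_rfl h4, key 2 (by norm_num) h2]
  exact hm

theorem HasGaussianMoments.fourth_moment_le {X : Type*} [Fintype X] {d : ℕ}
    {w : X → ℝ} (hw : ∀ x, 0 ≤ w x) {v : X → Fin d → ℂ} (h2 : HasGaussianMoments w v 2)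
    (h4 : HasGaussianMoments w v 4) (ξ : Matrix (Fin d) (Fin d) ℂ) :
    ∑ x, w x * ‖rankOneForm (v x) ξ‖ ^ 4
      ≤ 18 * (∑ x, w x * ‖rankOneForm (v x) ξ‖ ^ 2) ^ 2 := by
  -- `ξ = A + iB` with `A`, `B` Hermitian, so `|f_ξ|² = f_A² + f_B²`; the triangle inequality in L²
  -- for `f_A²` and `f_B²` keeps the constant 18.
  let A : Matrix (Fin d) (Fin d) ℂ := (2⁻¹ : ℂ) • (ξ + ξᴴ)
  let B : Matrix (Fin d) (Fin d) ℂ := (-(Complex.I / 2)) • (ξ - ξᴴ)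
  have hA : A.IsHermitian := by
    simp [A, Matrix.IsHermitian, Matrix.conjTranspose_smul, add_comm]
  have hB : B.IsHermitian := by
    simp only [B, Matrix.IsHermitian, Matrix.conjTranspose_smul, Matrix.conjTranspose_sub,
      Matrix.conjTranspose_conjTranspose]
    ext i j
    simp
    ring
  have hAB : ∀ x, rankOneForm (v x) ξ = rankOneForm (v x) A + Complex.I * rankOneForm (v x) B := by
    intro x
    simp only [rankOneForm, Finset.mul_sum, ← Finset.sum_add_distrib]
    refine Finset.sum_congr rfl fun j _ => ?_
    simp only [A, B, Matrix.smul_apply, Matrix.add_apply, Matrix.sub_apply, smul_eq_mul]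
    linear_combination (-(1 / 2) * v x j.1 * star (v x j.2) * (ξ j.2 j.1 - ξᴴ j.2 j.1)) *
      (-Complex.I_sq)
  set f : X → ℝ := fun x => (rankOneForm (v x) A).re
  set g : X → ℝ := fun x => (rankOneForm (v x) B).re
  have hn : ∀ x, ‖rankOneForm (v x) ξ‖ ^ 2 = f x ^ 2 + g x ^ 2 := by
    intro x
    rw [hAB, rankOneForm_re _ hA, rankOneForm_re _ hB, ← Complex.normSq_eq_norm_sq,
      Complex.normSq_apply]
    simp [f, g]
    ring
  have hn4 : ∀ x, ‖rankOneForm (v x) ξ‖ ^ 4 = (f x ^ 2 + g x ^ 2) ^ 2 := by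
    intro x
    rw [← hn]; ring
  simp only [hn, hn4]
  have hf := h2.fourth_moment_le_of_isHermitian h4 hA
  have hg := h2.fourth_moment_le_of_isHermitian h4 hB
  have hp : ∀ f : X → ℝ, 0 ≤ ∑ x, w x * f x ^ 2 := fun f =>
    Finset.sum_nonneg fun x _ => mul_nonneg (hw x) (sq_nonneg _)
  have key := sum_weighted_sq_sum_le (X := Bool) (w := fun _ => 1) (fun _ => zero_le_one) hw
    (fun s x => if s then f x ^ 2 else g x ^ 2)
    (c := fun s => Real.sqrt 18 * if s then ∑ x, w x * f x ^ 2 else ∑ x, w x * g x ^ 2)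
    (fun s => mul_nonneg (Real.sqrt_nonneg _) (by split_ifs <;> exact hp _))
    (by
      intro s
      rw [mul_pow, Real.sq_sqrt (by norm_num)]
      cases s
      · simpa [← pow_mul] using hg
      · simpa [← pow_mul] using hf)
  simp only [Fintype.sum_bool, one_mul, if_true, Bool.false_eq_true, if_false] at key
  refine key.trans (le_of_eq ?_)
  rw [← mul_add, mul_pow, Real.sq_sqrt (by norm_num), ← Finset.sum_add_distrib]
  simp only [mul_add]

theorem card_perm_fin_two {β : Type*} [DecidableEq β] (a b a' b' : β) :
    ((Finset.univ.filter fun σ : Equiv.Perm (Fin 2) => ![b, b'] = ![a, a'] ∘ σ).card : ℂ)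
      = (if b = a ∧ b' = a' then 1 else 0) + if b = a' ∧ b' = a then 1 else 0 := by
  have hu : (Finset.univ : Finset (Equiv.Perm (Fin 2))) = {1, Equiv.swap 0 1} := by decide
  have hne : (1 : Equiv.Perm (Fin 2)) ≠ Equiv.swap 0 1 := by decide
  rw [Finset.card_filter, hu, Finset.sum_pair hne]
  push_cast
  congr 1 <;> simp [funext_iff, Fin.forall_fin_two]

/-- The two permutations of two letters produce the two terms: one pairing gives `|tr ξ|²`, the
other the Hilbert–Schmidt norm. -/
theorem HasGaussianMoments.second_moment {X : Type*} [Fintype X] {d : ℕ}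
    {w : X → ℝ} {v : X → Fin d → ℂ} (h2 : HasGaussianMoments w v 2)
    (ξ : Matrix (Fin d) (Fin d) ℂ) :
    ∑ x, w x * ‖rankOneForm (v x) ξ‖ ^ 2 = ‖ξ.trace‖ ^ 2 + ∑ j : Fin d × Fin d, ‖ξ j.2 j.1‖ ^ 2 := by
  apply Complex.ofReal_injective
  have e : ∀ x, ((‖rankOneForm (v x) ξ‖ ^ 2 : ℝ) : ℂ)
      = ∑ a, ∑ b, ∑ a', ∑ b', ξ b a * star (ξ b' a') *
          ∏ l, (v x (![a, b'] l) * star (v x (![b, a'] l))) := by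
    intro x
    rw [← Complex.normSq_eq_norm_sq, ← Complex.mul_conj, ← Complex.star_def, rankOneForm,
      star_sum, Finset.sum_mul_sum, Fintype.sum_prod_type]
    refine Finset.sum_congr rfl fun a _ => Finset.sum_congr rfl fun b _ => ?_
    rw [Fintype.sum_prod_type]
    refine Finset.sum_congr rfl fun a' _ => Finset.sum_congr rfl fun b' _ => ?_
    simp only [Fin.prod_univ_two, star_mul', star_star, Matrix.cons_val_zero, Matrix.cons_val_one]
    ring
  have e2 : ∀ z : ℂ, ((‖z‖ ^ 2 : ℝ) : ℂ) = z * star z := fun z => by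
    rw [← Complex.normSq_eq_norm_sq, ← Complex.mul_conj, Complex.star_def]
  rw [Complex.ofReal_sum]
  simp only [Complex.ofReal_mul, e, Finset.mul_sum]
  rw [Finset.sum_comm, Complex.ofReal_add, Complex.ofReal_sum, e2, Fintype.sum_prod_type,
    Matrix.trace, star_sum, Finset.sum_mul_sum, ← Finset.sum_add_distrib]
  simp only [e2]
  refine Finset.sum_congr rfl fun a _ => ?_
  have e3 : ∀ b a' b', ∑ x, (w x : ℂ) * (ξ b a * star (ξ b' a') *
      ∏ l, (v x (![a, b'] l) * star (v x (![b, a'] l))))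
      = (if a = b ∧ b' = a' then ξ b a * star (ξ b' a') else 0)
        + if a = a' ∧ b' = b then ξ b a * star (ξ b' a') else 0 := by
    intro b a' b'
    have := h2 ![b, a'] ![a, b']
    rw [card_perm_fin_two] at this
    simp only [mul_left_comm (w _ : ℂ), ← Finset.mul_sum, this, mul_add, mul_ite, mul_one, mul_zero]
  rw [Finset.sum_comm]
  calc _ = ∑ b, ∑ a', ∑ b', ((if a = b ∧ b' = a' then ξ b a * star (ξ b' a') else 0)
        + if a = a' ∧ b' = b then ξ b a * star (ξ b' a') else 0) := by
        refine Finset.sum_congr rfl fun b _ => ?_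
        rw [Finset.sum_comm]
        refine Finset.sum_congr rfl fun a' _ => ?_
        rw [Finset.sum_comm]
        exact Finset.sum_congr rfl fun b' _ => e3 b a' b'
    _ = _ := by
        simp only [Finset.sum_add_distrib, ite_and]
        simp [Matrix.diag]

/-! ### Reducing the number of vectors -/

/-- The monomial `∏_{i ∈ s} z_i`. -/
def monomialAt {d k : ℕ} (z : Fin d → ℂ) (s : Sym (Fin d) k) : ℂ := (s.1.map z).prod

/-- The values of the monomials of bidegrees `(k, k)`, `k ∈ {1, 2, 4}`, as real numbers. -/
noncomputable def momentVector {d : ℕ} (z : Fin d → ℂ) :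
    (Σ t : Fin 3, Sym (Fin d) (![1, 2, 4] t) × Sym (Fin d) (![1, 2, 4] t)) → ℝ :=
  fun i => (monomialAt z i.2.1 * star (monomialAt z i.2.2)).re
    + (monomialAt z i.2.1 * star (monomialAt z i.2.2)).im

/-- The left side is the number of points that Carathéodory's theorem needs in the space of moment
vectors. -/
theorem card_momentIndex_lt {d : ℕ} (hd : 2 ≤ d) :
    Fintype.card (Σ t : Fin 3, Sym (Fin d) (![1, 2, 4] t) × Sym (Fin d) (![1, 2, 4] t)) + 1
      ≤ d ^ 8 := by
  have h1 : Fintype.card (Sym (Fin d) 1) = d := by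
    rw [Sym.card_sym_eq_multichoose, Nat.multichoose_one_right, Fintype.card_fin]
  have h2 : Fintype.card (Sym (Fin d) 2) ≤ d ^ 2 := by
    rw [Sym.card_sym_eq_multichoose, Nat.multichoose_eq, Fintype.card_fin]
    have := Nat.descFactorial_eq_factorial_mul_choose (d + 2 - 1) 2
    simp only [Nat.descFactorial, Nat.factorial, show d + 2 - 1 = d + 1 by omega,
      show d + 1 - 1 = d by omega, Nat.sub_zero, mul_one] at this ⊢
    nlinarith
  have h4 : 2 * Fintype.card (Sym (Fin d) 4) ≤ d ^ 4 := by
    rw [Sym.card_sym_eq_multichoose, Nat.multichoose_eq, Fintype.card_fin]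
    have := Nat.descFactorial_eq_factorial_mul_choose (d + 4 - 1) 4
    simp only [Nat.descFactorial, Nat.factorial, show d + 4 - 1 = d + 3 by omega,
      show d + 3 - 1 = d + 2 by omega, show d + 3 - 2 = d + 1 by omega,
      show d + 3 - 3 = d by omega, Nat.sub_zero, mul_one] at this ⊢
    -- For `d ≥ 2` this gives `24 · card ≤ 12 d^4`; the factor 2 gained here leaves room for the
    -- lower-degree moments and the extra point.
    have a1 : d * ((d + 1) * ((d + 2) * (d + 3))) ≤ d * ((2 * d) * ((2 * d) * (3 * d))) := by
      gcongr <;> omega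
    nlinarith
  rw [Fintype.card_sigma, Fin.sum_univ_three, Fintype.card_prod, Fintype.card_prod,
    Fintype.card_prod]
  change Fintype.card (Sym (Fin d) 1) * Fintype.card (Sym (Fin d) 1)
    + Fintype.card (Sym (Fin d) 2) * Fintype.card (Sym (Fin d) 2)
    + Fintype.card (Sym (Fin d) 4) * Fintype.card (Sym (Fin d) 4) + 1 ≤ d ^ 8
  rw [h1]
  have b2 := Nat.mul_le_mul h2 h2
  have b4 := Nat.mul_le_mul h4 h4
  have hD : 4 ≤ d ^ 2 := by nlinarith
  have e4 : d ^ 4 = d ^ 2 * d ^ 2 := by ring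
  have e8 : d ^ 8 = (d ^ 2 * d ^ 2) * (d ^ 2 * d ^ 2) := by ring
  rw [e8]
  rw [e4] at b4
  have e1 : d * d = d ^ 2 := by ring
  rw [e1]
  generalize d ^ 2 = D at *
  have c1 : 4 * 4 ≤ D * D := Nat.mul_le_mul hD hD
  have c2 : 16 * (D * D) ≤ (D * D) * (D * D) := Nat.mul_le_mul_right _ c1
  nlinarith

/-- Swapping the two monomials conjugates the moment, so the coordinates at `(s, r)` and `(r, s)`
are `re + im` and `re - im` of the same number. One real coordinate per ordered pair therefore
determines the complex moments. -/
theorem HasGaussianMoments.of_momentVector_eq {X Y : Type*} [Fintype X] [Fintype Y] {d : ℕ}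
    {w : X → ℝ} {v : X → Fin d → ℂ} {w' : Y → ℝ} {v' : Y → Fin d → ℂ}
    (h : ∑ y, w' y • momentVector (v' y) = ∑ x, w x • momentVector (v x)) (t : Fin 3)
    (hG : HasGaussianMoments w v (![1, 2, 4] t)) : HasGaussianMoments w' v' (![1, 2, 4] t) := by
  intro a b
  rw [← hG a b]
  have e : ∀ z : Fin d → ℂ, ∏ l, (z (b l) * star (z (a l)))
      = monomialAt z (⟨Finset.univ.val.map b, by simp⟩ : Sym (Fin d) (![1, 2, 4] t)) *
        star (monomialAt z (⟨Finset.univ.val.map a, by simp⟩ : Sym (Fin d) (![1, 2, 4] t))) := by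
    intro z
    simp only [monomialAt, Multiset.map_map, Finset.prod_mul_distrib]
    congr 1
    exact (star_prod _ _).symm
  simp only [e]
  generalize (⟨Finset.univ.val.map b, by simp⟩ : Sym (Fin d) (![1, 2, 4] t)) = s
  generalize (⟨Finset.univ.val.map a, by simp⟩ : Sym (Fin d) (![1, 2, 4] t)) = r
  have h1 := congrFun h ⟨t, s, r⟩
  have h2 := congrFun h ⟨t, r, s⟩
  simp only [Finset.sum_apply, Pi.smul_apply, smul_eq_mul, momentVector] at h1 h2
  have conj : ∀ z : Fin d → ℂ, monomialAt z r * star (monomialAt z s)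
      = star (monomialAt z s * star (monomialAt z r)) := by
    intro z; rw [star_mul', star_star, mul_comm]
  simp only [conj] at h2
  simp only [Complex.star_def, Complex.conj_re, Complex.conj_im, mul_add, mul_neg,
    Finset.sum_add_distrib, Finset.sum_neg_distrib] at h1 h2
  apply Complex.ext
  · simp only [Complex.re_sum, Complex.re_ofReal_mul, Complex.star_def]
    linarith
  · simp only [Complex.im_sum, Complex.im_ofReal_mul, Complex.star_def]
    linarith

theorem exists_hasGaussianMoments_card_le {d : ℕ} (hd : 2 ≤ d) :
    ∃ (N : ℕ) (w : Fin N → ℝ) (v : Fin N → Fin d → ℂ), N ≤ d ^ 8 ∧ (∀ x, 0 ≤ w x) ∧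
      HasGaussianMoments w v 1 ∧ HasGaussianMoments w v 2 ∧ HasGaussianMoments w v 4 := by
  obtain ⟨q, z, hq, hz⟩ := exists_law_gaussian_moments
  set W : (Fin d → Fin 3 × Fin 5) → ℝ := fun x => ∏ i, q (x i)
  set V : (Fin d → Fin 3 × Fin 5) → Fin d → ℂ := fun x i => z (x i)
  have hG : ∀ k ≤ 4, HasGaussianMoments W V k := fun k hk => hasGaussianMoments_pi hz d hk
  have hW0 : ∀ x, 0 ≤ W x := fun x => Finset.prod_nonneg fun i _ => hq _
  -- The moment of bidegree (0,0) is the total mass, and there is one permutation of the empty set.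
  have hW1 : ∑ x, W x = 1 := by
    have := hG 0 (by norm_num) Fin.elim0 Fin.elim0
    apply Complex.ofReal_injective
    rw [Complex.ofReal_sum]
    simpa [Finset.filter_true_of_mem] using this
  have hmem : ∑ x, W x • momentVector (V x)
      ∈ convexHull ℝ (Set.range fun x => momentVector (V x)) :=
    (convex_convexHull ℝ _).sum_mem (fun x _ => hW0 x) hW1
      fun x _ => subset_convexHull ℝ _ (Set.mem_range_self x)
  -- Carathéodory: the mean moment vector is a convex combination of affinely independent ones, at
  -- most dimension plus one of them.
  obtain ⟨ι, _, y, w, hy, hind, hw, -, hsum⟩ := eq_pos_convex_span_of_mem_convexHull hmem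
  have hcard : Fintype.card ι ≤ d ^ 8 := by
    refine hind.card_le_finrank_succ.trans (le_trans ?_ (card_momentIndex_lt hd))
    refine Nat.succ_le_succ ((Submodule.finrank_le _).trans ?_)
    rw [Module.finrank_fintype_fun_eq_card]
  choose x hx using fun i => hy (Set.mem_range_self i)
  have e := Fintype.equivFin ι
  have h : ∑ i, w (e.symm i) • momentVector (V (x (e.symm i)))
      = ∑ x, W x • momentVector (V x) := by
    rw [← hsum, ← e.symm.sum_comp]
    exact Finset.sum_congr rfl fun i _ => by rw [← hx]
  refine ⟨Fintype.card ι, fun i => w (e.symm i), fun i => V (x (e.symm i)), hcard,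
    fun i => (hw _).le, ?_, ?_, ?_⟩
  · exact HasGaussianMoments.of_momentVector_eq h 0 (hG 1 (by norm_num))
  · exact HasGaussianMoments.of_momentVector_eq h 1 (hG 2 (by norm_num))
  · exact HasGaussianMoments.of_momentVector_eq h 2 (hG 4 (by norm_num))

/-! ### Existence of a tomographic measurement -/

theorem sum_eigenvalues_conjTranspose_mul_self {β : Type} [Fintype β] [DecidableEq β]
    (A : Matrix β β ℂ) :
    ∑ b, (Matrix.isHermitian_conjTranspose_mul_self A).eigenvalues b
      = ∑ p : β × β, ‖A p.2 p.1‖ ^ 2 := by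
  apply Complex.ofReal_injective
  have := (Matrix.isHermitian_conjTranspose_mul_self A).trace_eq_sum_eigenvalues
  rw [Complex.ofReal_sum, Complex.ofReal_sum]
  refine this.symm.trans ?_
  rw [Matrix.trace, Fintype.sum_prod_type]
  refine Finset.sum_congr rfl fun a _ => ?_
  rw [Matrix.diag_apply, Matrix.mul_apply]
  refine Finset.sum_congr rfl fun b _ => ?_
  rw [Matrix.conjTranspose_apply, ← Complex.normSq_eq_norm_sq, ← Complex.mul_conj,
    Complex.star_def, mul_comm]

theorem eigenvalues_conjTranspose_mul_self_nonneg {β : Type} [Fintype β] [DecidableEq β]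
    (A : Matrix β β ℂ) (b : β) :
    0 ≤ (Matrix.isHermitian_conjTranspose_mul_self A).eigenvalues b :=
  (Matrix.posSemidef_conjTranspose_mul_self A).eigenvalues_nonneg b

theorem traceNorm_nonneg {β : Type} [Fintype β] [DecidableEq β] (A : Matrix β β ℂ) :
    0 ≤ traceNorm A := Finset.sum_nonneg fun _ _ => Real.sqrt_nonneg _

/-- The trace norm is bounded by the Hilbert–Schmidt norm. -/
theorem traceNorm_sq_le {β : Type} [Fintype β] [DecidableEq β] (A : Matrix β β ℂ) :
    traceNorm A ^ 2 ≤ Fintype.card β * ∑ p : β × β, ‖A p.2 p.1‖ ^ 2 := by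
  rw [← sum_eigenvalues_conjTranspose_mul_self, traceNorm]
  refine sq_sum_le_card_mul_sum_sq.trans (le_of_eq ?_)
  rw [Finset.card_univ]
  congr 1
  exact Finset.sum_congr rfl fun b _ =>
    Real.sq_sqrt (eigenvalues_conjTranspose_mul_self_nonneg A b)

theorem traceNorm_zero {β : Type} [Fintype β] [DecidableEq β] :
    traceNorm (0 : Matrix β β ℂ) = 0 := by
  have := traceNorm_sq_le (0 : Matrix β β ℂ)
  simp only [Matrix.zero_apply, norm_zero, ne_eq, OfNat.ofNat_ne_zero, not_false_eq_true,
    zero_pow, Finset.sum_const_zero, mul_zero] at this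
  exact pow_eq_zero_iff two_ne_zero |>.mp (le_antisymm this (sq_nonneg _))

/-- The measurement with the effects `w_x v_x v_x*`. -/
noncomputable def rankOneMeasurement {d N : ℕ} (w : Fin N → ℝ) (v : Fin N → Fin d → ℂ)
    (hw : ∀ x, 0 ≤ w x) (h : HasGaussianMoments w v 1) : Measurement d N where
  effect x := (w x : ℂ) • Matrix.vecMulVec (v x) (star (v x))
  posSemidef x := (Matrix.posSemidef_vecMulVec_self_star (v x)).smul
    (by exact_mod_cast hw x)
  sum_eq_one := by
    ext i j
    have := h (fun _ => j) fun _ => i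
    simp only [Fin.prod_univ_one] at this
    rw [Matrix.sum_apply]
    simp only [Matrix.smul_apply, Matrix.vecMulVec_apply, Pi.star_apply, smul_eq_mul, this,
      Matrix.one_apply]
    have e : ∀ σ : Equiv.Perm (Fin 1), ((fun _ : Fin 1 => i) = (fun _ => j) ∘ σ) ↔ i = j :=
      fun σ => by simp [funext_iff]
    simp only [e]
    split_ifs with hij <;> simp [hij]

theorem rankOneMeasurement_apply {d N k : ℕ} (w : Fin N → ℝ) (v : Fin N → Fin d → ℂ)
    (hw : ∀ x, 0 ≤ w x) (h : HasGaussianMoments w v 1) (ξ : QuditOp d (Fin k))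
    (x : Fin k → Fin N) :
    (rankOneMeasurement w v hw h).apply ξ x = (∏ l, (w (x l) : ℂ)) *
      tensorApply (fun x (j : Fin d × Fin d) => v x j.1 * star (v x j.2))
        (fun j => ξ (fun l => (j l).2) fun l => (j l).1) x := by
  rw [tensorApply, ← (Equiv.arrowProdEquivProdArrow _ _ _).symm.sum_comp, Fintype.sum_prod_type,
    Measurement.apply, Matrix.trace, Finset.mul_sum]
  refine Finset.sum_congr rfl fun a _ => ?_
  rw [Matrix.diag_apply, Matrix.mul_apply, Finset.mul_sum]
  refine Finset.sum_congr rfl fun b _ => ?_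
  simp only [tensorOp, Matrix.of_apply, rankOneMeasurement, Matrix.smul_apply,
    Matrix.vecMulVec_apply, Pi.star_apply, smul_eq_mul, Finset.prod_mul_distrib,
    Equiv.arrowProdEquivProdArrow, Equiv.coe_fn_symm_mk, mul_assoc]

theorem rankOneMeasurement_isTomographic {d N : ℕ} (hd : 0 < d) (hN : N ≤ d ^ 8) (w : Fin N → ℝ)
    (v : Fin N → Fin d → ℂ) (hw : ∀ x, 0 ≤ w x) (h1 : HasGaussianMoments w v 1)
    (h2 : HasGaussianMoments w v 2) (h4 : HasGaussianMoments w v 4) :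
    (rankOneMeasurement w v hw h1).IsTomographic := by
  refine ⟨hN, fun k _ ξ _ => ?_⟩
  set T : Fin N → Fin d × Fin d → ℂ := fun x j => v x j.1 * star (v x j.2)
  set G : (Fin k → Fin d × Fin d) → ℂ := fun j => ξ (fun l => (j l).2) fun l => (j l).1
  set A := ∑ x : Fin k → Fin N, ‖(rankOneMeasurement w v hw h1).apply ξ x‖
  have hA : A = ∑ x : Fin k → Fin N, (∏ l, w (x l)) * ‖tensorApply T G x‖ := by
    refine Finset.sum_congr rfl fun x _ => ?_
    rw [rankOneMeasurement_apply, norm_mul, ← Complex.ofReal_prod, Complex.norm_real,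
      Real.norm_of_nonneg (Finset.prod_nonneg fun l _ => hw _)]
  have hA0 : 0 ≤ A := Finset.sum_nonneg fun x _ => norm_nonneg _
  have hT : ∀ (x : Fin N) (η : Fin d × Fin d → ℂ),
      ∑ j, T x j * η j = rankOneForm (v x) (Matrix.of fun b a => η (a, b)) := fun x η => rfl
  have key := sum_norm_sq_le_sq_tensorApply (T := T) hw (Real.sqrt_nonneg 18)
    (fun η => by
      simp only [hT, h2.second_moment]
      exact le_add_of_nonneg_left (sq_nonneg _))
    (fun η => by
      rw [Real.sq_sqrt (by norm_num)]
      simp only [hT]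
      exact h2.fourth_moment_le hw h4 _) k G
  rw [← hA] at key
  have hG : ∑ j, ‖G j‖ ^ 2 = ∑ p : (Fin k → Fin d) × (Fin k → Fin d), ‖ξ p.2 p.1‖ ^ 2 := by
    rw [← (Equiv.arrowProdEquivProdArrow _ _ _).symm.sum_comp]
    rfl
  have hD : (0 : ℝ) < 18 * d := by positivity
  have hsq : traceNorm ξ ^ 2 ≤ ((18 * (d : ℝ)) ^ ((k : ℝ) / 2) * A) ^ 2 := by
    refine (traceNorm_sq_le ξ).trans ?_
    rw [← hG]
    refine (mul_le_mul_of_nonneg_left key (Nat.cast_nonneg _)).trans (le_of_eq ?_)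
    have e1 : ((18 * (d : ℝ)) ^ ((k : ℝ) / 2)) ^ 2 = (18 * (d : ℝ)) ^ k := by
      rw [← Real.rpow_natCast, ← Real.rpow_mul hD.le]
      simp
    have e2 : (Real.sqrt 18 ^ k) ^ 2 = 18 ^ k := by
      rw [← pow_mul, mul_comm, pow_mul, Real.sq_sqrt (by norm_num)]
    rw [mul_pow, mul_pow, e1, e2, mul_pow]
    simp only [Fintype.card_pi, Fintype.card_fin, Finset.prod_const, Finset.card_univ]
    push_cast
    ring
  have hP : 0 < (18 * (d : ℝ)) ^ ((k : ℝ) / 2) := Real.rpow_pos_of_pos hD _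
  rw [div_mul_eq_mul_div, one_mul, div_le_iff₀ hP, mul_comm A]
  exact le_of_sq_le_sq hsq (mul_nonneg hP.le hA0)

/-- The measurement with a single outcome. -/
def trivialMeasurement (d : ℕ) : Measurement d 1 where
  effect _ := 1
  posSemidef _ := Matrix.PosSemidef.one
  sum_eq_one := by simp

/-- For `d = 1` the bound `d^8` allows only one outcome, too few for the general construction; but a
traceless operator is then zero. -/
theorem trivialMeasurement_isTomographic : (trivialMeasurement 1).IsTomographic := by
  refine ⟨by norm_num, fun k _ ξ hξ => ?_⟩
  have : ξ = 0 := by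
    ext a b
    rw [Matrix.trace, Fintype.sum_subsingleton _ a] at hξ
    rw [Subsingleton.elim b a]
    exact hξ
  rw [this, traceNorm_zero, mul_zero]
  exact Finset.sum_nonneg fun x _ => norm_nonneg _

theorem exists_isTomographic {d : ℕ} (hd : 0 < d) :
    ∃ (N : ℕ) (M : Measurement d N), M.IsTomographic := by
  rcases Nat.eq_or_lt_of_le (Nat.succ_le_of_lt hd) with rfl | h
  · exact ⟨1, _, trivialMeasurement_isTomographic⟩
  · obtain ⟨N, w, v, hN, hw, h1, h2, h4⟩ := exists_hasGaussianMoments_card_le h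
    exact ⟨N, _, rankOneMeasurement_isTomographic hd hN w v hw h1 h2 h4⟩

/-! ### Classical entropies -/

/-- A Pinsker-type inequality, by way of the Hellinger distance. -/
theorem sq_sum_abs_sub_le_four_mul_kl {Y : Type*} [Fintype Y] {r s : Y → ℝ} (hr : ∀ y, 0 ≤ r y)
    (hs : ∀ y, 0 ≤ s y) (hr1 : ∑ y, r y = 1) (hs1 : ∑ y, s y = 1) (hrs : ∀ y, s y = 0 → r y = 0) :
    (∑ y, |r y - s y|) ^ 2 ≤ 4 * ∑ y, r y * (Real.log (r y) - Real.log (s y)) := by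
  have h1 : (∑ y, |r y - s y|) ^ 2 ≤ (∑ y, (Real.sqrt (r y) - Real.sqrt (s y)) ^ 2) *
      ∑ y, (Real.sqrt (r y) + Real.sqrt (s y)) ^ 2 := by
    have := Finset.sum_mul_sq_le_sq_mul_sq Finset.univ
      (fun y => |Real.sqrt (r y) - Real.sqrt (s y)|) fun y => Real.sqrt (r y) + Real.sqrt (s y)
    simp only [sq_abs] at this
    refine le_trans (le_of_eq ?_) this
    congr 1
    refine Finset.sum_congr rfl fun y _ => ?_
    have e := abs_mul (Real.sqrt (r y) - Real.sqrt (s y)) (Real.sqrt (r y) + Real.sqrt (s y))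
    rw [abs_of_nonneg (add_nonneg (Real.sqrt_nonneg (r y)) (Real.sqrt_nonneg (s y)))] at e
    rw [← e]
    congr 1
    linear_combination (Real.sq_sqrt (hs y)) - Real.sq_sqrt (hr y)
  have h2 : ∑ y, (Real.sqrt (r y) + Real.sqrt (s y)) ^ 2 ≤ 4 := by
    calc _ ≤ ∑ y, (2 * r y + 2 * s y) := Finset.sum_le_sum fun y _ => by
          nlinarith [sq_nonneg (Real.sqrt (r y) - Real.sqrt (s y)), Real.sq_sqrt (hs y),
            Real.sq_sqrt (hr y)]
      _ = 4 := by
          rw [Finset.sum_add_distrib, ← Finset.mul_sum, ← Finset.mul_sum, hr1, hs1]; norm_num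
  have h3 : ∑ y, (Real.sqrt (r y) - Real.sqrt (s y)) ^ 2
      ≤ ∑ y, r y * (Real.log (r y) - Real.log (s y)) := by
    have e : ∑ y, (Real.sqrt (r y) - Real.sqrt (s y)) ^ 2
        = ∑ y, 2 * (r y - Real.sqrt (r y) * Real.sqrt (s y)) := by
      have : ∀ y, (Real.sqrt (r y) - Real.sqrt (s y)) ^ 2
          = 2 * (r y - Real.sqrt (r y) * Real.sqrt (s y)) + (s y - r y) := fun y => by
        linear_combination Real.sq_sqrt (hs y) + Real.sq_sqrt (hr y)
      simp only [this, Finset.sum_add_distrib, Finset.sum_sub_distrib, hr1, hs1]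
      ring
    rw [e]
    refine Finset.sum_le_sum fun y _ => ?_
    rcases (hr y).eq_or_lt with h0 | h0
    · rw [← h0]; simp
    have hs0 : 0 < s y := (hs y).lt_of_ne fun h => h0.ne' (hrs y h.symm)
    have hsr := Real.sqrt_pos.mpr h0
    have hss := Real.sqrt_pos.mpr hs0
    -- `log u ≤ u - 1` is applied at `u = √(s/r)`, which turns the divergence into a Hellinger
    -- distance.
    have hlog : Real.log (s y) - Real.log (r y)
        ≤ 2 * (Real.sqrt (s y) / Real.sqrt (r y) - 1) := by
      have := Real.log_le_sub_one_of_pos (div_pos hss hsr)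
      rw [Real.log_div hss.ne' hsr.ne', Real.log_sqrt hs0.le, Real.log_sqrt h0.le] at this
      linarith
    have hm := mul_le_mul_of_nonneg_left hlog h0.le
    have e3 : r y * (Real.sqrt (s y) / Real.sqrt (r y)) = Real.sqrt (r y) * Real.sqrt (s y) := by
      rw [mul_div_assoc', div_eq_iff hsr.ne']
      linear_combination (-Real.sqrt (s y)) * Real.sq_sqrt (hr y)
    nlinarith
  calc _ ≤ _ := h1
    _ ≤ (∑ y, (Real.sqrt (r y) - Real.sqrt (s y)) ^ 2) * 4 :=
        mul_le_mul_of_nonneg_left h2 (Finset.sum_nonneg fun y _ => sq_nonneg _)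
    _ ≤ _ := by rw [mul_comm]; exact mul_le_mul_of_nonneg_left h3 (by norm_num)

/-- Gibbs' inequality. -/
theorem gibbs_inequality {Y : Type*} [Fintype Y] {r s : Y → ℝ} (hr : ∀ y, 0 ≤ r y)
    (hs : ∀ y, 0 ≤ s y) (hrs1 : ∑ y, s y ≤ ∑ y, r y) (hrs : ∀ y, s y = 0 → r y = 0) :
    ∑ y, r y * Real.log (s y) ≤ ∑ y, r y * Real.log (r y) := by
  have : ∑ y, (r y * Real.log (s y) - r y * Real.log (r y)) ≤ ∑ y, (s y - r y) := by
    refine Finset.sum_le_sum fun y _ => ?_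
    rcases (hr y).eq_or_lt with h0 | h0
    · rw [← h0]; simpa using hs y
    have hs0 : 0 < s y := (hs y).lt_of_ne fun h => h0.ne' (hrs y h.symm)
    have := Real.log_le_sub_one_of_pos (div_pos hs0 h0)
    rw [Real.log_div hs0.ne' h0.ne'] at this
    have hm := mul_le_mul_of_nonneg_left this h0.le
    have e : r y * (s y / r y - 1) = s y - r y := by field_simp
    rw [e] at hm
    linarith
  rw [Finset.sum_sub_distrib, Finset.sum_sub_distrib] at this
  linarith

/-! ### Marginals and Shannon entropies of a distribution on strings. -/

section Marginals

variable {S B : Type*} [Fintype S] [DecidableEq S] [Fintype B]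

/-- The marginal distribution of the coordinates `g`. -/
noncomputable def margProb (p : (S → B) → ℝ) {κ : Type*} (g : κ → S) (x : κ → B) : ℝ :=
  open scoped Classical in ∑ z, if z ∘ g = x then p z else 0

/-- The negative Shannon entropy of the coordinates `g`. -/
noncomputable def negEntropy (p : (S → B) → ℝ) {κ : Type*} (g : κ → S) : ℝ :=
  ∑ z, p z * Real.log (margProb p g (z ∘ g))

theorem margProb_nonneg {p : (S → B) → ℝ} (hp : ∀ z, 0 ≤ p z) {κ : Type*} (g : κ → S)
    (x : κ → B) : 0 ≤ margProb p g x :=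
  Finset.sum_nonneg fun z _ => by split_ifs; exacts [hp z, le_rfl]

theorem sum_margProb_mul (p : (S → B) → ℝ) {κ : Type*} [Fintype κ] [DecidableEq κ] (g : κ → S)
    (φ : (κ → B) → ℝ) : ∑ x, margProb p g x * φ x = ∑ z, p z * φ (z ∘ g) := by
  simp only [margProb, Finset.sum_mul]
  rw [Finset.sum_comm]
  refine Finset.sum_congr rfl fun z _ => ?_
  rw [Fintype.sum_eq_single (z ∘ g) fun x hx => by rw [if_neg hx.symm, zero_mul], if_pos rfl]

theorem sum_margProb (p : (S → B) → ℝ) {κ : Type*} [Fintype κ] [DecidableEq κ] (g : κ → S) :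
    ∑ x, margProb p g x = ∑ z, p z := by
  simpa using sum_margProb_mul p g fun _ => 1

theorem negEntropy_eq_sum (p : (S → B) → ℝ) {κ : Type*} [Fintype κ] [DecidableEq κ] (g : κ → S) :
    negEntropy p g = ∑ x, margProb p g x * Real.log (margProb p g x) :=
  (sum_margProb_mul p g fun x => Real.log (margProb p g x)).symm

theorem margProb_le_comp {p : (S → B) → ℝ} (hp : ∀ z, 0 ≤ p z) {κ κ' : Type*} (g : κ → S)
    (e : κ' → κ) (x : κ → B) : margProb p g x ≤ margProb p (g ∘ e) (x ∘ e) := by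
  refine Finset.sum_le_sum fun z _ => ?_
  by_cases h : z ∘ g = x
  · rw [if_pos h, if_pos (by rw [← h]; rfl)]
  · rw [if_neg h]
    split_ifs
    exacts [hp z, le_rfl]

/-- Reordering or repeating coordinates does not change which strings agree on them, so the entropy
depends only on the set of coordinates. -/
theorem negEntropy_comp_surjective (p : (S → B) → ℝ) {κ κ' : Type*} (g : κ → S) {e : κ' → κ}
    (he : Function.Surjective e) : negEntropy p (g ∘ e) = negEntropy p g := by
  refine Finset.sum_congr rfl fun z _ => ?_
  congr 2
  refine Finset.sum_congr rfl fun z' _ => ?_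
  have : z' ∘ g ∘ e = z ∘ g ∘ e ↔ z' ∘ g = z ∘ g :=
    ⟨fun h => he.injective_comp_right h, fun h => congrArg (· ∘ e) h⟩
  classical exact if_congr this rfl rfl

theorem sum_margProb_elim (p : (S → B) → ℝ) {κ κ' : Type*} [Fintype κ']
    [DecidableEq κ'] (g : κ → S) (g' : κ' → S) (x : κ → B) :
    ∑ y, margProb p (Sum.elim g g') (Sum.elim x y) = margProb p g x := by
  simp only [margProb]
  rw [Finset.sum_comm]
  refine Finset.sum_congr rfl fun z _ => ?_
  have : ∀ y, z ∘ Sum.elim g g' = Sum.elim x y ↔ z ∘ g = x ∧ y = z ∘ g' := by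
    intro y
    simp only [funext_iff, Sum.forall, Function.comp_apply, Sum.elim_inl, Sum.elim_inr]
    exact and_congr_right fun _ => forall_congr' fun _ => eq_comm
  by_cases h : z ∘ g = x
  · rw [Fintype.sum_eq_single (z ∘ g') fun y hy => if_neg fun h' => hy ((this y).mp h').2,
      if_pos ((this _).mpr ⟨h, rfl⟩), if_pos h]
  · rw [if_neg h]
    exact Finset.sum_eq_zero fun y _ => if_neg fun h' => h ((this y).mp h').1

end Marginals

/-! ### Conditional total correlation and bounds on conditional entropies. -/

section Entropies

variable {S B : Type*} [Fintype S] [DecidableEq S] [Fintype B]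

/-- The total correlation of the coordinates `i`, conditioned on the coordinates `j`. -/
noncomputable def totalCorrelation (p : (S → B) → ℝ) {κ κ' : Type*} [Fintype κ'] (j : κ → S)
    (i : κ' → S) : ℝ :=
  negEntropy p (Sum.elim j i) - negEntropy p j
    - ∑ l, (negEntropy p (Sum.elim j fun _ : Unit => i l) - negEntropy p j)

theorem sum_margProb_elim_unit (p : (S → B) → ℝ) {κ : Type*} (j : κ → S) (s : S) (x : κ → B) :
    ∑ c, margProb p (Sum.elim j fun _ : Unit => s) (Sum.elim x fun _ => c) = margProb p j x := by
  rw [← sum_margProb_elim p j (fun _ : Unit => s) x, ← (Equiv.funUnique Unit B).symm.sum_comp]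
  rfl

/-- For fixed outcomes `x` at `j`, the Pinsker-type bound compares the conditional law at `i` with
the product of its marginals. The average over `x` of these divergences is the total correlation. -/
theorem sum_margProb_mul_sq_le_totalCorrelation [DecidableEq B] {p : (S → B) → ℝ}
    (hp : ∀ z, 0 ≤ p z)
    {κ κ' : Type*} [Fintype κ] [DecidableEq κ] [Fintype κ'] [DecidableEq κ'] (j : κ → S)
    (i : κ' → S) :
    ∑ x, margProb p j x * (∑ y, |margProb p (Sum.elim j i) (Sum.elim x y) / margProb p j x
        - ∏ l, margProb p (Sum.elim j fun _ : Unit => i l) (Sum.elim x fun _ => y l)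
          / margProb p j x|) ^ 2
      ≤ 4 * totalCorrelation p j i := by
  -- The log-likelihood ratio of the conditional joint law against the product of the conditional
  -- marginals; its mean is the total correlation.
  let φ : (κ ⊕ κ' → B) → ℝ := fun w => Real.log (margProb p (Sum.elim j i) w)
    - Real.log (margProb p j (w ∘ Sum.inl))
    - ∑ l, (Real.log (margProb p (Sum.elim j fun _ : Unit => i l)
        (Sum.elim (w ∘ Sum.inl) fun _ => w (Sum.inr l)))
      - Real.log (margProb p j (w ∘ Sum.inl)))
  have htot : totalCorrelation p j i
      = ∑ x, ∑ y, margProb p (Sum.elim j i) (Sum.elim x y) * φ (Sum.elim x y) := by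
    have h1 := sum_margProb_mul p (Sum.elim j i) φ
    rw [← (Equiv.sumArrowEquivProdArrow κ κ' B).symm.sum_comp, Fintype.sum_prod_type] at h1
    refine Eq.trans ?_ h1.symm
    have e : ∀ (z : S → B) l, z ∘ (Sum.elim j fun _ : Unit => i l)
        = Sum.elim (z ∘ j) fun _ => z (i l) := fun z l => by
      funext s; cases s <;> rfl
    simp only [totalCorrelation, negEntropy, φ, mul_sub, Finset.sum_sub_distrib, Finset.mul_sum, e]
    rw [Finset.sum_comm (s := (Finset.univ : Finset κ')), Finset.sum_comm (s := (Finset.univ : Finset κ'))]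
    rfl
  rw [htot, Finset.mul_sum]
  refine Finset.sum_le_sum fun x _ => ?_
  have hP := margProb_nonneg hp (κ := κ) j x
  rcases hP.eq_or_lt with h0 | h0
  · have : ∀ y, margProb p (Sum.elim j i) (Sum.elim x y) = 0 := fun y =>
      le_antisymm ((margProb_le_comp hp (Sum.elim j i) Sum.inl (Sum.elim x y)).trans h0.symm.le)
        (margProb_nonneg hp _ _)
    simp [this, ← h0]
  have h1 : ∑ y, margProb p (Sum.elim j i) (Sum.elim x y) / margProb p j x = 1 := by
    rw [← Finset.sum_div, sum_margProb_elim, div_self h0.ne']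
  have h2 : ∑ y : κ' → B, ∏ l, margProb p (Sum.elim j fun _ : Unit => i l)
      (Sum.elim x fun _ => y l) / margProb p j x = 1 := by
    have := Finset.prod_univ_sum (fun _ : κ' => (Finset.univ : Finset B)) fun l c =>
      margProb p (Sum.elim j fun _ : Unit => i l) (Sum.elim x fun _ => c) / margProb p j x
    rw [Fintype.piFinset_univ] at this
    rw [← this]
    refine Finset.prod_eq_one fun l _ => ?_
    rw [← Finset.sum_div, sum_margProb_elim_unit, div_self h0.ne']
  have hle : ∀ y l, margProb p (Sum.elim j i) (Sum.elim x y)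
      ≤ margProb p (Sum.elim j fun _ : Unit => i l) (Sum.elim x fun _ => y l) := by
    intro y l
    have := margProb_le_comp hp (Sum.elim j i) (Sum.map id fun _ : Unit => l) (Sum.elim x y)
    rwa [Sum.elim_comp_map, Sum.elim_comp_map] at this
  have hkl := sq_sum_abs_sub_le_four_mul_kl
    (fun y => div_nonneg (margProb_nonneg hp (Sum.elim j i) (Sum.elim x y)) hP)
    (fun y => Finset.prod_nonneg fun l _ => div_nonneg
      (margProb_nonneg hp (Sum.elim j fun _ : Unit => i l) (Sum.elim x fun _ => y l)) hP)
    h1 h2 (by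
      intro y hy
      obtain ⟨l, -, hl⟩ := Finset.prod_eq_zero_iff.mp hy
      have h3 : margProb p (Sum.elim j fun _ : Unit => i l) (Sum.elim x fun _ => y l) = 0 :=
        (div_eq_zero_iff.mp hl).resolve_right h0.ne'
      rw [le_antisymm ((hle y l).trans h3.le) (margProb_nonneg hp _ _), zero_div])
  refine (mul_le_mul_of_nonneg_left hkl hP).trans (le_of_eq ?_)
  rw [mul_left_comm, Finset.mul_sum]
  congr 1
  refine Finset.sum_congr rfl fun y _ => ?_
  rw [← mul_assoc, mul_div_cancel₀ _ h0.ne']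
  rcases (margProb_nonneg hp (Sum.elim j i) (Sum.elim x y)).eq_or_lt with hy | hy
  · rw [← hy, zero_mul, zero_mul]
  congr 1
  have hl : ∀ l, 0 < margProb p (Sum.elim j fun _ : Unit => i l) (Sum.elim x fun _ => y l) :=
    fun l => hy.trans_le (hle y l)
  rw [Real.log_div hy.ne' h0.ne', Real.log_prod fun l _ => (div_pos (hl l) h0).ne']
  simp only [φ, Sum.elim_comp_inl, Sum.elim_inr]
  congr 1
  exact Finset.sum_congr rfl fun l _ => Real.log_div (hl l).ne' h0.ne'

variable {p : (S → B) → ℝ} {q : B → ℝ} {D : ℝ}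

/-- The entropy of a coordinate, conditioned on others, is at most the cross entropy with any
distribution `q`. -/
theorem cross_le_negEntropy_sub (hp : ∀ z, 0 ≤ p z) (hq : ∀ c, 0 ≤ q c) (hq1 : ∑ c, q c = 1)
    (hq0 : ∀ z s, q (z s) = 0 → p z = 0) {κ : Type*} [Fintype κ] [DecidableEq κ] (g : κ → S)
    (s : S) :
    ∑ z, p z * Real.log (q (z s))
      ≤ negEntropy p (Sum.elim g fun _ : Unit => s) - negEntropy p g := by
  classical
  have hR : ∑ w : κ ⊕ Unit → B, margProb p g (w ∘ Sum.inl) * q (w (Sum.inr ()))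
      = ∑ w, margProb p (Sum.elim g fun _ : Unit => s) w := by
    rw [sum_margProb, ← sum_margProb p g, ← (Equiv.sumArrowEquivProdArrow κ Unit B).symm.sum_comp,
      Fintype.sum_prod_type]
    refine Finset.sum_congr rfl fun x _ => ?_
    change ∑ y : Unit → B, margProb p g x * q (y ()) = _
    rw [← Finset.mul_sum, ← (Equiv.funUnique Unit B).symm.sum_comp]
    change _ * ∑ c, q c = _
    rw [hq1, mul_one]
  have hle : ∀ w, margProb p (Sum.elim g fun _ : Unit => s) w ≤ margProb p g (w ∘ Sum.inl) :=
    fun w => margProb_le_comp hp (Sum.elim g fun _ : Unit => s) Sum.inl w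
  have hq0' : ∀ w, q (w (Sum.inr ())) = 0 →
      margProb p (Sum.elim g fun _ : Unit => s) w = 0 := by
    intro w hw
    refine Finset.sum_eq_zero fun z _ => ?_
    split_ifs with h
    · refine hq0 z s ?_
      rw [← hw, ← h]
      rfl
    · rfl
  have hgibbs := gibbs_inequality
    (fun w => margProb_nonneg hp (Sum.elim g fun _ : Unit => s) w)
    (fun w => mul_nonneg (margProb_nonneg hp g (w ∘ Sum.inl)) (hq (w (Sum.inr ())))) hR.le
    (by
      intro w hw
      rcases mul_eq_zero.mp hw with h | h
      · exact le_antisymm ((hle w).trans h.le) (margProb_nonneg hp _ _)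
      · exact hq0' w h)
  rw [← negEntropy_eq_sum] at hgibbs
  have e : ∑ w, margProb p (Sum.elim g fun _ : Unit => s) w *
      Real.log (margProb p g (w ∘ Sum.inl) * q (w (Sum.inr ())))
      = negEntropy p g + ∑ z, p z * Real.log (q (z s)) := by
    have e1 : ∀ w, margProb p (Sum.elim g fun _ : Unit => s) w *
        Real.log (margProb p g (w ∘ Sum.inl) * q (w (Sum.inr ())))
        = margProb p (Sum.elim g fun _ : Unit => s) w *
          (Real.log (margProb p g (w ∘ Sum.inl)) + Real.log (q (w (Sum.inr ())))) := by
      intro w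
      rcases (margProb_nonneg hp (Sum.elim g fun _ : Unit => s) w).eq_or_lt with h | h
      · rw [← h, zero_mul, zero_mul]
      rw [Real.log_mul (h.trans_le (hle w)).ne' fun h' => h.ne' (hq0' w h')]
    rw [Finset.sum_congr rfl fun w _ => e1 w, sum_margProb_mul]
    simp only [mul_add, Finset.sum_add_distrib]
    rfl
  linarith

/-- If the coordinate `s`, conditioned on others, has a law dominated by `D q`, then its entropy is
at least the cross entropy with `q` minus `log D`. -/
theorem negEntropy_sub_le_cross (hp : ∀ z, 0 ≤ p z) (hp1 : ∑ z, p z = 1) (hq : ∀ c, 0 ≤ q c)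
    (hD : 0 < D) {κ : Type*} [Fintype κ] [DecidableEq κ] (g : κ → S) (s : S)
    (hdom : ∀ x c, margProb p (Sum.elim g fun _ : Unit => s) (Sum.elim x fun _ => c)
      ≤ D * q c * margProb p g x) :
    negEntropy p (Sum.elim g fun _ : Unit => s) - negEntropy p g
      ≤ ∑ z, p z * Real.log (q (z s)) + Real.log D := by
  rw [← mul_one (Real.log D), ← hp1, Finset.mul_sum, negEntropy, negEntropy,
    ← Finset.sum_sub_distrib, ← Finset.sum_add_distrib]
  refine Finset.sum_le_sum fun z _ => ?_
  rcases (hp z).eq_or_lt with h | h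
  · simp [← h]
  have hpos : ∀ {κ : Type _} (g : κ → S), p z ≤ margProb p g (z ∘ g) := by
    intro κ g
    have := Finset.single_le_sum (f := fun z' => open scoped Classical in
        if z' ∘ g = z ∘ g then p z' else 0)
      (fun z' _ => by split_ifs; exacts [hp z', le_rfl]) (Finset.mem_univ z)
    simp only [if_true] at this
    exact this
  have h1 := h.trans_le (hpos (Sum.elim g fun _ : Unit => s))
  have h2 := h.trans_le (hpos g)
  have e : z ∘ (Sum.elim g fun _ : Unit => s) = Sum.elim (z ∘ g) fun _ => z s := by
    funext l; cases l <;> rfl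
  have h3 := hdom (z ∘ g) (z s)
  rw [← e] at h3
  have hqz : 0 < q (z s) := by
    refine (hq _).lt_of_ne fun h' => ?_
    rw [← h', mul_zero, zero_mul] at h3
    exact absurd h3 (not_le.mpr h1)
  have h4 := Real.log_le_log h1 h3
  rw [Real.log_mul (mul_pos hD hqz).ne' h2.ne', Real.log_mul hD.ne' hqz.ne'] at h4
  have := mul_le_mul_of_nonneg_left h4 h.le
  nlinarith

end Entropies

/-! ### Averages over embeddings and permutations -/

theorem exists_perm_comp_embedding {κ S : Type*} [Finite S] (e e' : κ ↪ S) :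
    ∃ τ : Equiv.Perm S, ∀ l, τ (e l) = e' l := by
  classical
  have := Fintype.ofFinite S
  let f : {s // s ∈ Set.range e} ≃ {s // s ∈ Set.range e'} :=
    (Equiv.ofInjective e e.injective).symm.trans (Equiv.ofInjective e' e'.injective)
  refine ⟨f.extendSubtype, fun l => ?_⟩
  rw [Equiv.extendSubtype_apply_of_mem f (e l) ⟨l, rfl⟩]
  have : (⟨e l, ⟨l, rfl⟩⟩ : {s // s ∈ Set.range e}) = Equiv.ofInjective e e.injective l := rfl
  simp only [f, this, Equiv.trans_apply, Equiv.symm_apply_apply]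
  rfl

section

variable {κ S : Type*} [Fintype S] [DecidableEq S]

theorem expect_perm_comp_embedding_eq (f : (κ → S) → ℝ) (e e' : κ ↪ S) :
    𝔼 σ : Equiv.Perm S, f (σ ∘ e) = 𝔼 σ : Equiv.Perm S, f (σ ∘ e') := by
  obtain ⟨τ, hτ⟩ := exists_perm_comp_embedding e e'
  have : τ ∘ e = e' := funext hτ
  refine (Fintype.expect_equiv (Equiv.mulRight τ) _ _ fun σ => ?_).symm
  rw [Equiv.coe_mulRight, Equiv.Perm.coe_mul, Function.comp_assoc, this]

/-- A uniformly random embedding is a uniformly random permutation of a fixed one. -/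
theorem expect_embedding_eq_expect_perm [Fintype κ] [DecidableEq κ] (f : (κ → S) → ℝ) (e : κ ↪ S) :
    𝔼 g : κ ↪ S, f g = 𝔼 σ : Equiv.Perm S, f (σ ∘ e) := by
  have : Nonempty (κ ↪ S) := ⟨e⟩
  -- After averaging over all relabellings `σ`, the value no longer depends on the embedding, so `g`
  -- may be replaced by `e`.
  calc 𝔼 g : κ ↪ S, f g = 𝔼 σ : Equiv.Perm S, 𝔼 g : κ ↪ S, f (σ ∘ g) := by
        rw [← Fintype.expect_const (ι := Equiv.Perm S) (𝔼 g : κ ↪ S, f g)]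
        refine Finset.expect_congr rfl fun σ _ => ?_
        exact Fintype.expect_equiv (Equiv.embeddingCongr (Equiv.refl κ) σ.symm) _ _ fun g => by
          congr 1
          funext l
          simp
    _ = 𝔼 g : κ ↪ S, 𝔼 σ : Equiv.Perm S, f (σ ∘ e) := by
        rw [Finset.expect_comm]
        exact Finset.expect_congr rfl fun g _ => expect_perm_comp_embedding_eq f g e
    _ = _ := Fintype.expect_const _

end

/-- Choosing first `j` and then `i` among the remaining sites is the same as choosing both at
once. -/
theorem expect_embedding_rest {n m k : ℕ} (hmk : m + k ≤ n) (f : (Fin m ⊕ Fin k → Fin n) → ℝ) :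
    𝔼 j : Fin m ↪ Fin n, 𝔼 i : Fin k ↪ Rest j, f (Sum.elim j fun l => (i l : Fin n))
      = 𝔼 g : Fin m ⊕ Fin k ↪ Fin n, f g := by
  let E : (Fin m ⊕ Fin k ↪ Fin n) ≃ Σ j : Fin m ↪ Fin n, Fin k ↪ Rest j :=
    (Equiv.sumEmbeddingEquivSigmaEmbeddingRestricted (α := Fin m) (β := Fin k) (γ := Fin n)).trans
      (Equiv.sigmaCongrRight fun j => Equiv.embeddingCongr (Equiv.refl _)
        (Equiv.subtypeEquivRight fun s => by simp))
  have hE : ∀ g, Sum.elim (E g).1 (fun l => ((E g).2 l : Fin n)) = g := by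
    intro g
    funext l
    cases l <;> rfl
  -- The number of choices of `i` is the same for every `j`, so the two-stage average is uniform
  -- over pairs.
  have hcard : ∀ j : Fin m ↪ Fin n, Fintype.card (Fin k ↪ Rest j) = (n - m).descFactorial k := by
    intro j
    rw [Fintype.card_embedding_eq, Fintype.card_fin]
    congr 1
    have h1 : Fintype.card {s : Fin n // ¬ ∀ l, j l ≠ s} = m := by
      refine (Fintype.card_congr ((Equiv.ofInjective j j.injective).trans
        (Equiv.subtypeEquivRight fun s => ?_))).symm.trans (Fintype.card_fin m)
      simp
    have h2 := Fintype.card_subtype_compl fun s : Fin n => ¬ ∀ l, j l ≠ s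
    simp only [not_not] at h2
    rw [h2, h1, Fintype.card_fin]
  have hc0 : ((n - m).descFactorial k : ℝ) ≠ 0 := by
    have : 0 < (n - m).descFactorial k := Nat.descFactorial_pos.mpr (by omega)
    exact_mod_cast this.ne'
  have hcE : (Fintype.card (Fin m ⊕ Fin k ↪ Fin n) : ℝ)
      = Fintype.card (Fin m ↪ Fin n) * (n - m).descFactorial k := by
    rw [Fintype.card_congr E, Fintype.card_sigma]
    simp only [hcard, Finset.sum_const, Finset.card_univ, smul_eq_mul, Nat.cast_mul]
  simp only [Fintype.expect_eq_sum_div_card, hcard]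
  rw [hcE, ← Finset.sum_div, div_div, mul_comm (((n - m).descFactorial k : ℕ) : ℝ)]
  congr 1
  rw [← E.symm.sum_comp, Fintype.sum_sigma]
  refine Finset.sum_congr rfl fun j _ => Finset.sum_congr rfl fun i _ => ?_
  have := hE (E.symm ⟨j, i⟩)
  rw [E.apply_symm_apply] at this
  rw [← this]

/-! ### The entropies of the first coordinates in a random order -/

section

variable {n : ℕ} {B : Type*} [Fintype B] (p : (Fin n → B) → ℝ)

/-- The average negative entropy of `r` random coordinates. -/
noncomputable def meanNegEntropy (r : ℕ) : ℝ :=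
  𝔼 σ : Equiv.Perm (Fin n), negEntropy p fun s : {s : Fin n // s.val < r} => σ s

theorem expect_perm_negEntropy {κ : Type*} (e : κ ↪ Fin n) {r : ℕ}
    (he : ∀ s : Fin n, s.val < r ↔ ∃ l, e l = s) :
    𝔼 σ : Equiv.Perm (Fin n), negEntropy p (σ ∘ e) = meanNegEntropy p r := by
  unfold meanNegEntropy
  congr 1
  funext σ
  let e' : κ → {s : Fin n // s.val < r} := fun l => ⟨e l, (he _).mpr ⟨l, rfl⟩⟩
  have hs : Function.Surjective e' := by
    rintro ⟨s, h⟩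
    obtain ⟨l, hl⟩ := (he s).mp h
    exact ⟨l, Subtype.ext hl⟩
  rw [← negEntropy_comp_surjective p (fun s : {s : Fin n // s.val < r} => σ s) hs]
  congr 1

/-- The sites `0, …, m - 1` and `m, …, m + k - 1`. -/
def initialSites {m k : ℕ} (hmk : m + k ≤ n) : Fin m ⊕ Fin k ↪ Fin n :=
  finSumFinEquiv.toEmbedding.trans (Fin.castLEEmb hmk)

/-- Once the sites are in random order, each entropy in the total correlation averages to a quantity
depending only on how many sites it involves: `m + k`, `m`, or `m + 1`. -/
theorem expect_totalCorrelation {m k : ℕ} (hmk : m + k ≤ n) :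
    𝔼 j : Fin m ↪ Fin n, 𝔼 i : Fin k ↪ Rest j,
        totalCorrelation p j (fun l => (i l : Fin n))
      = (meanNegEntropy p (m + k) - meanNegEntropy p m)
        - k * (meanNegEntropy p (m + 1) - meanNegEntropy p m) := by
  refine (expect_embedding_rest hmk fun g =>
    totalCorrelation p (g ∘ Sum.inl) (g ∘ Sum.inr)).trans ?_
  rw [expect_embedding_eq_expect_perm (fun g => totalCorrelation p (g ∘ Sum.inl) (g ∘ Sum.inr))
      (initialSites hmk)]
  have h1 : 𝔼 σ : Equiv.Perm (Fin n), negEntropy p (σ ∘ initialSites hmk)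
      = meanNegEntropy p (m + k) := by
    refine expect_perm_negEntropy p _ fun s => ⟨fun h => ?_, ?_⟩
    · exact ⟨finSumFinEquiv.symm ⟨s, h⟩, by simp [initialSites]⟩
    · rintro ⟨l, rfl⟩
      simp [initialSites]
  have h2 : 𝔼 σ : Equiv.Perm (Fin n), negEntropy p ((σ ∘ initialSites hmk) ∘ Sum.inl)
      = meanNegEntropy p m := by
    refine expect_perm_negEntropy p (Function.Embedding.inl.trans (initialSites hmk))
      fun s => ⟨fun h => ⟨⟨s, h⟩, by ext; simp [initialSites]⟩, ?_⟩
    rintro ⟨l, rfl⟩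
    simp [initialSites]
  have h3 : ∀ l : Fin k, 𝔼 σ : Equiv.Perm (Fin n), negEntropy p
      (Sum.elim ((σ ∘ initialSites hmk) ∘ Sum.inl)
        fun _ : Unit => ((σ ∘ initialSites hmk) ∘ Sum.inr) l) = meanNegEntropy p (m + 1) := by
    intro l
    have hm : m + 1 ≤ n := by have := l.2; omega
    let e₁ : Fin m ⊕ Unit ↪ Fin n :=
      ((Function.Embedding.refl _).sumMap ⟨fun _ : Unit => l, fun _ _ _ => rfl⟩).trans
        (initialSites hmk)
    let e₂ : Fin m ⊕ Unit ↪ Fin n :=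
      ((Function.Embedding.refl _).sumMap ⟨fun _ : Unit => (0 : Fin 1), fun _ _ _ => rfl⟩).trans
        (initialSites hm)
    have e : 𝔼 σ : Equiv.Perm (Fin n), negEntropy p (σ ∘ e₂) = meanNegEntropy p (m + 1) := by
      refine expect_perm_negEntropy p e₂ fun s => ⟨fun h => ?_, ?_⟩
      · rcases (Nat.lt_succ_iff_lt_or_eq.mp h) with h | h
        · exact ⟨Sum.inl ⟨s, h⟩, by ext; simp [e₂, initialSites]⟩
        · exact ⟨Sum.inr (), by ext; simp [e₂, initialSites, h]⟩
      · rintro ⟨l, rfl⟩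
        cases l <;> simp [e₂, initialSites]
    rw [← e, ← expect_perm_comp_embedding_eq _ e₁ e₂]
    refine Finset.expect_congr rfl fun σ _ => congrArg _ ?_
    funext s
    cases s <;> rfl
  have h0 : ∀ σ : Equiv.Perm (Fin n),
      totalCorrelation p ((σ ∘ initialSites hmk) ∘ Sum.inl) ((σ ∘ initialSites hmk) ∘ Sum.inr)
      = negEntropy p (σ ∘ initialSites hmk) - negEntropy p ((σ ∘ initialSites hmk) ∘ Sum.inl)
        - ∑ l, (negEntropy p (Sum.elim ((σ ∘ initialSites hmk) ∘ Sum.inl)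
            fun _ : Unit => ((σ ∘ initialSites hmk) ∘ Sum.inr) l)
          - negEntropy p ((σ ∘ initialSites hmk) ∘ Sum.inl)) := by
    intro σ
    rw [totalCorrelation, Sum.elim_comp_inl_inr]
  simp only [h0, Finset.expect_sub_distrib, Finset.expect_sum_comm, h1, h2, h3, Finset.sum_const,
    Finset.card_univ, Fintype.card_fin, nsmul_eq_mul]

variable {p} {q : B → ℝ} {D : ℝ}

theorem meanNegEntropy_succ_sub (hp : ∀ z, 0 ≤ p z) (hp1 : ∑ z, p z = 1) (hq : ∀ c, 0 ≤ q c)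
    (hq1 : ∑ c, q c = 1) (hq0 : ∀ z s, q (z s) = 0 → p z = 0) (hD : 0 < D)
    (hdom : ∀ (r : ℕ) (g : {s : Fin n // s.val < r} → Fin n) (s : Fin n), (∀ l, g l ≠ s) →
      ∀ x c, margProb p (Sum.elim g fun _ : Unit => s) (Sum.elim x fun _ => c)
        ≤ D * q c * margProb p g x) :
    ∃ G : ℝ, ∀ r < n, G ≤ meanNegEntropy p (r + 1) - meanNegEntropy p r ∧
      meanNegEntropy p (r + 1) - meanNegEntropy p r ≤ G + Real.log D := by
  classical
  -- `G` is the mean of `log q` over the outcome at a uniformly random site. It does not depend on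
  -- `r` because `σ r` is uniform for each `r`.
  refine ⟨𝔼 s : Fin n, ∑ z, p z * Real.log (q (z s)), fun r hr => ?_⟩
  have hG : 𝔼 s : Fin n, ∑ z, p z * Real.log (q (z s))
      = 𝔼 σ : Equiv.Perm (Fin n), ∑ z, p z * Real.log (q (z (σ ⟨r, hr⟩))) := by
    let e : Unit ↪ Fin n := ⟨fun _ => ⟨r, hr⟩, fun _ _ _ => rfl⟩
    refine Eq.trans ?_ (expect_embedding_eq_expect_perm (fun g : Unit → Fin n =>
      ∑ z, p z * Real.log (q (z (g ())))) e)
    exact Fintype.expect_equiv (Function.Embedding.oneEmbeddingEquiv).symm _ _ fun s => rfl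
  have h1 : meanNegEntropy p (r + 1) = 𝔼 σ : Equiv.Perm (Fin n), negEntropy p
      (Sum.elim (fun s : {s : Fin n // s.val < r} => σ s) fun _ : Unit => σ ⟨r, hr⟩) := by
    let e : {s : Fin n // s.val < r} ⊕ Unit ↪ Fin n :=
      ⟨Sum.elim Subtype.val fun _ => ⟨r, hr⟩, by
        rw [Sum.elim_injective]
        refine ⟨Subtype.val_injective, fun _ _ _ => rfl, fun a _ h => ?_⟩
        have := a.2
        rw [h] at this
        exact lt_irrefl _ this⟩
    rw [← expect_perm_negEntropy p e]
    · refine Finset.expect_congr rfl fun σ _ => congrArg _ ?_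
      funext s
      cases s <;> rfl
    · refine fun s => ⟨fun h => ?_, ?_⟩
      · rcases (Nat.lt_succ_iff_lt_or_eq.mp h) with h | h
        · exact ⟨Sum.inl ⟨s, h⟩, rfl⟩
        · exact ⟨Sum.inr (), Fin.ext h.symm⟩
      · rintro ⟨l, rfl⟩
        cases l with
        | inl s => exact s.2.trans (Nat.lt_succ_self r)
        | inr s => exact Nat.lt_succ_self r
  rw [hG, h1, meanNegEntropy, ← Finset.expect_sub_distrib]
  constructor
  · exact Finset.expect_le_expect fun σ _ => cross_le_negEntropy_sub hp hq hq1 hq0 _ _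
  · rw [← Fintype.expect_const (ι := Equiv.Perm (Fin n)) (Real.log D),
      ← Finset.expect_add_distrib]
    refine Finset.expect_le_expect fun σ _ => negEntropy_sub_le_cross hp hp1 hq hD _ _
      (hdom r _ _ fun l h => ?_)
    have h2 := congrArg Fin.val (σ.injective h)
    exact absurd h2 l.2.ne

/-- With `δ(r) = A(r+1) - A(r)`, the quantity is `∑_{l<k} (δ(m+l) - δ(m))`. No monotonicity of `δ`
is needed, only that its values on `r < n` lie in an interval of length `L`: a sum over `m ≤ t` of
unit shifts telescopes to a difference of two values of `δ`. -/
theorem exists_second_difference_le {A : ℕ → ℝ} {G L : ℝ} {t k n : ℕ} (htk : t + k ≤ n)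
    (hL : 0 ≤ L) (hA : ∀ r < n, G ≤ A (r + 1) - A r ∧ A (r + 1) - A r ≤ G + L) :
    ∃ m ≤ t, (A (m + k) - A m) - k * (A (m + 1) - A m) ≤ k ^ 2 * L / (t + 1) := by
  -- A shift by `l` consists of `l` unit shifts, each costing at most `L` after summation over `m`.
  have inner : ∀ l < k, ∑ m ∈ Finset.range (t + 1),
      ((A (m + l + 1) - A (m + l)) - (A (m + 1) - A m)) ≤ l * L := by
    intro l
    induction l with
    | zero => intro _; simp
    | succ l ih =>
      intro hl
      have h1 := ih (by omega)
      have h2 : ∑ m ∈ Finset.range (t + 1), ((A (m + (l + 1) + 1) - A (m + (l + 1)))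
          - (A (m + l + 1) - A (m + l)))
          = (A (t + 1 + l + 1) - A (t + 1 + l)) - (A (l + 1) - A l) := by
        have := Finset.sum_range_sub (fun m => A (m + l + 1) - A (m + l)) (t + 1)
        simp only [zero_add] at this
        rw [← this]
        refine Finset.sum_congr rfl fun m _ => ?_
        rw [show m + (l + 1) = m + 1 + l by ring]
      have h3 := (hA (t + 1 + l) (by omega)).2
      have h4 := (hA l (by omega)).1
      calc _ = ∑ m ∈ Finset.range (t + 1), ((A (m + (l + 1) + 1) - A (m + (l + 1)))
            - (A (m + l + 1) - A (m + l)))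
          + ∑ m ∈ Finset.range (t + 1), ((A (m + l + 1) - A (m + l)) - (A (m + 1) - A m)) := by
            rw [← Finset.sum_add_distrib]
            exact Finset.sum_congr rfl fun m _ => by ring
        _ ≤ _ := by rw [h2]; push_cast; linarith
  have total : ∑ m ∈ Finset.range (t + 1), ((A (m + k) - A m) - k * (A (m + 1) - A m))
      ≤ k ^ 2 * L := by
    calc _ = ∑ m ∈ Finset.range (t + 1), ∑ l ∈ Finset.range k,
          ((A (m + l + 1) - A (m + l)) - (A (m + 1) - A m)) := by
          refine Finset.sum_congr rfl fun m _ => ?_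
          rw [Finset.sum_sub_distrib, Finset.sum_const, Finset.card_range, nsmul_eq_mul]
          congr 1
          exact (Finset.sum_range_sub (fun l => A (m + l)) k).symm
      _ = ∑ l ∈ Finset.range k, ∑ m ∈ Finset.range (t + 1),
          ((A (m + l + 1) - A (m + l)) - (A (m + 1) - A m)) := Finset.sum_comm
      _ ≤ ∑ l ∈ Finset.range k, k * L := by
          refine Finset.sum_le_sum fun l hl => (inner l (Finset.mem_range.mp hl)).trans ?_
          refine mul_le_mul_of_nonneg_right ?_ hL
          exact_mod_cast (Finset.mem_range.mp hl).le
      _ = k ^ 2 * L := by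
          rw [Finset.sum_const, Finset.card_range, nsmul_eq_mul]; ring
  by_contra! hcon
  have : ∑ m ∈ Finset.range (t + 1), k ^ 2 * L / (t + 1 : ℝ)
      < ∑ m ∈ Finset.range (t + 1), ((A (m + k) - A m) - k * (A (m + 1) - A m)) :=
    Finset.sum_lt_sum_of_nonempty ⟨0, by simp⟩ fun m hm =>
      hcon m (Nat.lt_succ_iff.mp (Finset.mem_range.mp hm))
  rw [Finset.sum_const, Finset.card_range, nsmul_eq_mul] at this
  push_cast at this
  rw [mul_div_cancel₀ _ (by positivity)] at this
  linarith

end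

/-! ### Measurement outcomes -/

theorem ite_congr_of_iff {α : Type*} {P Q : Prop} {iP : Decidable P} {iQ : Decidable Q} {a b c : α}
    (h : P ↔ Q) (hab : a = b) : (if P then a else c) = if Q then b else c := by
  by_cases hP : P
  · rw [if_pos hP, if_pos (h.mp hP), hab]
  · rw [if_neg hP, if_neg fun hQ => hP (h.mpr hQ)]

/-- Shared bookkeeping for `marginal` and `unnormalizedPost`: the kernel `K` lives on the fibres of
`f`, so the outer sums collapse and a pairing with a reduced operator becomes a sum over full
configurations. -/
theorem sum_mul_sum_fiber {U A : Type*} [Fintype U] [Fintype A] (f : U → A) (W : A → A → ℂ)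
    (σ : U → U → ℂ) (K : A → A → U → U → ℂ)
    (h1 : ∀ u v, K (f u) (f v) u v = σ u v)
    (h0 : ∀ a b u v, ¬ (f u = a ∧ f v = b) → K a b u v = 0) :
    ∑ a, ∑ b, W a b * ∑ u, ∑ v, K a b u v = ∑ u, ∑ v, W (f u) (f v) * σ u v := by
  have e : ∑ a, ∑ b, W a b * ∑ u, ∑ v, K a b u v
      = ∑ q : U × U, ∑ p : A × A, W p.1 p.2 * K p.1 p.2 q.1 q.2 := by
    rw [Finset.sum_comm (s := (Finset.univ : Finset (U × U))), Fintype.sum_prod_type]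
    simp only [Fintype.sum_prod_type, Finset.mul_sum]
  rw [e, Fintype.sum_prod_type]
  refine Finset.sum_congr rfl fun u _ => Finset.sum_congr rfl fun v _ => ?_
  rw [Fintype.sum_eq_single (f u, f v), h1]
  rintro ⟨a, b⟩ hab
  rw [h0, mul_zero]
  rintro ⟨rfl, rfl⟩
  exact hab rfl

theorem trace_tensorOp_mul {d : ℕ} {κ : Type} [Fintype κ] [DecidableEq κ]
    (A : κ → Matrix (Fin d) (Fin d) ℂ) (ξ : QuditOp d κ) :
    (tensorOp A * ξ).trace = ∑ u, ∑ v, (∏ l, A l (v l) (u l)) * ξ u v := by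
  rw [Matrix.trace, Finset.sum_comm]
  simp only [Matrix.diag_apply, Matrix.mul_apply, tensorOp, Matrix.of_apply]

theorem trace_tensorOp_mul_marginal {d : ℕ} {ι κ : Type} [Fintype ι] [DecidableEq ι] [Fintype κ]
    [DecidableEq κ] (A : κ → Matrix (Fin d) (Fin d) ℂ) (σ : QuditOp d ι) (i : κ ↪ ι) :
    (tensorOp A * marginal σ i).trace
      = ∑ u, ∑ v, (if ∀ s, (∀ l, i l ≠ s) → u s = v s then
          ∏ l, A l (v (i l)) (u (i l)) else 0) * σ u v := by
  rw [trace_tensorOp_mul]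
  refine (sum_mul_sum_fiber (fun (u : ι → Fin d) (l : κ) => u (i l))
    (fun a b => ∏ l, A l (b l) (a l))
    (fun u v => if ∀ s, (∀ l, i l ≠ s) → u s = v s then σ u v else 0) _ (fun u v => ?_)
    fun a b u v h => if_neg fun h' => h ⟨funext h'.1, funext h'.2.1⟩).trans ?_
  · simp
  · exact Finset.sum_congr rfl fun u _ => Finset.sum_congr rfl fun v _ => by split_ifs <;> simp

theorem sum_mul_unnormalizedPost {d N n m : ℕ} (M : Measurement d N) (ρ : QuditOp d (Fin n))
    (j : Fin m ↪ Fin n) (x : Fin m → Fin N) (W : (Rest j → Fin d) → (Rest j → Fin d) → ℂ) :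
    ∑ a, ∑ b, W a b * unnormalizedPost M ρ j x a b
      = ∑ u : Fin n → Fin d, ∑ v : Fin n → Fin d, W (fun s => u s) (fun s => v s) *
          ((∏ l, M.effect (x l) (v (j l)) (u (j l))) * ρ u v) :=
  sum_mul_sum_fiber (fun (u : Fin n → Fin d) (s : Rest j) => u s) W
    (fun u v => (∏ l, M.effect (x l) (v (j l)) (u (j l))) * ρ u v) _
    (fun _ _ => if_pos ⟨fun _ => rfl, fun _ => rfl⟩)
    fun _ _ _ _ h => if_neg fun h' => h ⟨funext h'.1, funext h'.2⟩

open scoped MatrixOrder Matrix.Norms.L2Operator in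
theorem exists_eq_conjTranspose_mul_self {β : Type*} [Fintype β] [DecidableEq β]
    {A : Matrix β β ℂ} (hA : A.PosSemidef) : ∃ B : Matrix β β ℂ, A = Bᴴ * B :=
  CStarAlgebra.nonneg_iff_eq_star_mul_self.mp (Matrix.nonneg_iff_posSemidef.mpr hA)

theorem tensorOp_posSemidef {d : ℕ} {κ : Type} [Fintype κ] [DecidableEq κ]
    {A : κ → Matrix (Fin d) (Fin d) ℂ} (hA : ∀ l, (A l).PosSemidef) : (tensorOp A).PosSemidef := by
  choose B hB using fun l => exists_eq_conjTranspose_mul_self (hA l)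
  have : tensorOp A = (tensorOp B)ᴴ * tensorOp B := by
    ext a b
    simp only [tensorOp, Matrix.mul_apply, Matrix.conjTranspose_apply, Matrix.of_apply]
    simp only [hB, Matrix.mul_apply, Matrix.conjTranspose_apply]
    rw [Finset.prod_univ_sum, Fintype.piFinset_univ]
    simp only [Finset.prod_mul_distrib, star_prod]
  rw [this]
  exact Matrix.posSemidef_conjTranspose_mul_self _

theorem trace_mul_nonneg {β : Type} [Fintype β] [DecidableEq β] {A ρ : Matrix β β ℂ}
    (hA : A.PosSemidef) (hρ : ρ.PosSemidef) : 0 ≤ (A * ρ).trace := by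
  obtain ⟨B, rfl⟩ := exists_eq_conjTranspose_mul_self hρ
  rw [← Matrix.mul_assoc, Matrix.trace_mul_comm, ← Matrix.mul_assoc]
  exact (hA.mul_mul_conjTranspose_same B).trace_nonneg

/-- In an eigenbasis: each eigenvalue is at most the sum of all of them. This operator inequality is
the source of `log d` in the final bound. -/
theorem trace_smul_one_sub_posSemidef {d : ℕ} {A : Matrix (Fin d) (Fin d) ℂ}
    (hA : A.PosSemidef) : (A.trace • (1 : Matrix (Fin d) (Fin d) ℂ) - A).PosSemidef := by
  set U : Matrix (Fin d) (Fin d) ℂ := hA.1.eigenvectorUnitary.1 with hU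
  have hUU : U * Uᴴ = 1 := Unitary.coe_mul_star_self hA.1.eigenvectorUnitary
  have hs : A = U * Matrix.diagonal (fun i => (hA.1.eigenvalues i : ℂ)) * Uᴴ := by
    conv_lhs => rw [hA.1.spectral_theorem, Unitary.conjStarAlgAut_apply]
    rfl
  have e : A.trace • (1 : Matrix (Fin d) (Fin d) ℂ) - A
      = U * Matrix.diagonal (fun i => A.trace - (hA.1.eigenvalues i : ℂ)) * Uᴴ := by
    have : Matrix.diagonal (fun i => A.trace - (hA.1.eigenvalues i : ℂ))
        = A.trace • (1 : Matrix (Fin d) (Fin d) ℂ)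
          - Matrix.diagonal (fun i => (hA.1.eigenvalues i : ℂ)) := by
      rw [Matrix.smul_one_eq_diagonal, Matrix.diagonal_sub]
    rw [this, Matrix.mul_sub, Matrix.sub_mul, ← hs, Matrix.mul_smul, Matrix.mul_one,
      Matrix.smul_mul, hUU]
  rw [e]
  refine (Matrix.PosSemidef.diagonal fun i => ?_).mul_mul_conjTranspose_same U
  have h := Finset.single_le_sum (fun i _ => hA.eigenvalues_nonneg i) (Finset.mem_univ i)
  have h' := Complex.real_le_real.mpr h
  rw [Complex.ofReal_sum] at h'
  rw [Pi.zero_apply, hA.1.trace_eq_sum_eigenvalues, sub_nonneg]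
  exact h'

/-! ### The classical distribution of outcomes and its relation to post-measurement states. -/

section Outcomes

variable {d N n : ℕ} (M : Measurement d N) (ρ : QuditOp d (Fin n))

/-- The probability of the outcomes `z` when all sites are measured. -/
noncomputable def outcomeDist (z : Fin n → Fin N) : ℝ := (M.apply ρ z).re

variable {ρ}

theorem apply_nonneg (hρ : ρ.PosSemidef) (z : Fin n → Fin N) : 0 ≤ M.apply ρ z :=
  trace_mul_nonneg (tensorOp_posSemidef fun l => M.posSemidef (z l)) hρ

theorem ofReal_outcomeDist (hρ : ρ.PosSemidef) (z : Fin n → Fin N) :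
    (outcomeDist M ρ z : ℂ) = M.apply ρ z :=
  (Complex.eq_re_of_ofReal_le (r := 0) (by exact_mod_cast apply_nonneg M hρ z)).symm

theorem outcomeDist_nonneg (hρ : ρ.PosSemidef) (z : Fin n → Fin N) : 0 ≤ outcomeDist M ρ z :=
  (Complex.nonneg_iff.mp (apply_nonneg M hρ z)).1

/-- Sites outside the range of `g` are summed over all outcomes; there the effects add up to the
identity, which forces `u s = v s`, as in a partial trace. -/
theorem sum_prod_effect_fiber {κ : Type*} [Fintype κ] [DecidableEq κ] {g : κ → Fin n}
    (hg : Function.Injective g)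
    (x : κ → Fin N) {_ : ∀ z : Fin n → Fin N, Decidable (z ∘ g = x)} (u v : Fin n → Fin d) :
    ∑ z : Fin n → Fin N, (if z ∘ g = x then ∏ s, M.effect (z s) (v s) (u s) else 0)
      = if ∀ s, (∀ l, g l ≠ s) → u s = v s then
          ∏ l, M.effect (x l) (v (g l)) (u (g l)) else 0 := by
  classical
  have e1 : ∀ z : Fin n → Fin N, (if z ∘ g = x then ∏ s, M.effect (z s) (v s) (u s) else 0)
      = ∏ s, if ∀ l, g l = s → z s = x l then M.effect (z s) (v s) (u s) else 0 := by
    intro z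
    rw [Finset.prod_ite_zero]
    refine ite_congr_of_iff ⟨?_, ?_⟩ rfl
    · rintro rfl s _ l rfl
      rfl
    · intro h
      funext l
      exact h (g l) (Finset.mem_univ _) l rfl
  have e2 := Finset.prod_univ_sum (fun _ : Fin n => (Finset.univ : Finset (Fin N))) fun s c =>
    if ∀ l, g l = s → c = x l then M.effect c (v s) (u s) else 0
  rw [Fintype.piFinset_univ] at e2
  rw [Finset.sum_congr rfl fun z _ => e1 z, ← e2,
    ← Finset.prod_mul_prod_compl (Finset.univ.map ⟨g, hg⟩), Finset.prod_map]
  have e3 : ∀ l, (∑ c, if ∀ l', g l' = g l → c = x l' then M.effect c (v (g l)) (u (g l)) else 0)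
      = M.effect (x l) (v (g l)) (u (g l)) := by
    intro l
    rw [Fintype.sum_eq_single (x l) fun c hc => if_neg fun h => hc (h l rfl), if_pos]
    exact fun l' h => by rw [hg h]
  have e4 : ∏ s ∈ (Finset.univ.map ⟨g, hg⟩)ᶜ,
      (∑ c, if ∀ l, g l = s → c = x l then M.effect c (v s) (u s) else 0)
      = if ∀ s, (∀ l, g l ≠ s) → u s = v s then 1 else 0 := by
    have : ∀ s ∈ (Finset.univ.map ⟨g, hg⟩ : Finset (Fin n))ᶜ,
        (∑ c, if ∀ l, g l = s → c = x l then M.effect c (v s) (u s) else 0)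
          = if u s = v s then (1 : ℂ) else 0 := by
      intro s hs
      have hs' : ∀ l, g l ≠ s := by simpa using hs
      have h := congrFun (congrFun M.sum_eq_one (v s)) (u s)
      rw [Matrix.sum_apply, Matrix.one_apply] at h
      rw [if_congr (eq_comm (a := u s)) rfl rfl, ← h]
      exact Finset.sum_congr rfl fun c _ => if_pos fun l hl => absurd hl (hs' l)
    rw [Finset.prod_congr rfl this, Finset.prod_ite_zero, Finset.prod_const_one]
    refine ite_congr_of_iff ?_ rfl
    simp
  rw [e4, mul_ite, mul_one, mul_zero]
  simp only [Function.Embedding.coeFn_mk, e3]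

theorem ofReal_margProb_outcomeDist (hρ : ρ.PosSemidef) {κ : Type*} [Fintype κ] [DecidableEq κ]
    {g : κ → Fin n} (hg : Function.Injective g) (x : κ → Fin N) :
    (margProb (outcomeDist M ρ) g x : ℂ)
      = ∑ u, ∑ v, (if ∀ s, (∀ l, g l ≠ s) → u s = v s then
          ∏ l, M.effect (x l) (v (g l)) (u (g l)) else 0) * ρ u v := by
  classical
  rw [margProb, Complex.ofReal_sum]
  have e : ∀ z (_ : Decidable (z ∘ g = x)), ((if z ∘ g = x then outcomeDist M ρ z else 0 : ℝ) : ℂ)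
      = ∑ u, ∑ v, (if z ∘ g = x then ∏ s, M.effect (z s) (v s) (u s) else 0) * ρ u v := by
    intro z _
    split_ifs
    · rw [ofReal_outcomeDist M hρ, Measurement.apply, trace_tensorOp_mul]
    · simp
  refine (Finset.sum_congr rfl fun z _ => e z _).trans ?_
  rw [Finset.sum_comm]
  refine Finset.sum_congr rfl fun u _ => ?_
  rw [Finset.sum_comm]
  refine Finset.sum_congr rfl fun v _ => ?_
  rw [← Finset.sum_mul]
  exact congrArg (· * ρ u v) (sum_prod_effect_fiber M hg x u v)

theorem sum_outcomeDist (hρ : IsDensity ρ) : ∑ z, outcomeDist M ρ z = 1 := by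
  have h := ofReal_margProb_outcomeDist M hρ.1 (g := (Fin.elim0 : Fin 0 → Fin n))
    (fun a => a.elim0) Fin.elim0
  rw [← sum_margProb (outcomeDist M ρ) (Fin.elim0 : Fin 0 → Fin n)]
  rw [Fintype.sum_unique]
  apply Complex.ofReal_injective
  rw [Subsingleton.elim (default : Fin 0 → Fin N) Fin.elim0, h, Complex.ofReal_one, ← hρ.2,
    Matrix.trace]
  refine Finset.sum_congr rfl fun u _ => ?_
  rw [Fintype.sum_eq_single u]
  · simp
  · intro v hv
    rw [if_neg, zero_mul]
    exact fun h => hv (funext fun s => (h s fun l => l.elim0).symm)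

theorem sum_apply {k : ℕ} (ξ : QuditOp d (Fin k)) : ∑ y, M.apply ξ y = ξ.trace := by
  have h : ∀ u v : Fin k → Fin d, ∑ y : Fin k → Fin N, ∏ l, M.effect (y l) (v l) (u l)
      = if v = u then 1 else 0 := by
    intro u v
    have e2 := Finset.prod_univ_sum (fun _ : Fin k => (Finset.univ : Finset (Fin N))) fun l c =>
      M.effect c (v l) (u l)
    rw [Fintype.piFinset_univ] at e2
    rw [← e2]
    have : ∀ l, ∑ c, M.effect c (v l) (u l) = if v l = u l then 1 else 0 := fun l => by
      have h := congrFun (congrFun M.sum_eq_one (v l)) (u l)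
      rwa [Matrix.sum_apply, Matrix.one_apply] at h
    simp only [this, Finset.prod_ite_zero, Finset.mem_univ, true_imp_iff, funext_iff,
      Finset.prod_const_one]
  simp only [Measurement.apply, trace_tensorOp_mul]
  rw [Finset.sum_comm]
  refine Finset.sum_congr rfl fun u _ => ?_
  rw [Finset.sum_comm]
  simp only [← Finset.sum_mul, h, ite_mul, one_mul, zero_mul, Finset.sum_ite_eq', Finset.mem_univ,
    if_true, Matrix.diag_apply]

theorem ofReal_outcomeProb (hρ : ρ.PosSemidef) {m : ℕ} (j : Fin m ↪ Fin n) (x : Fin m → Fin N) :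
    (unnormalizedPost M ρ j x).trace = margProb (outcomeDist M ρ) j x := by
  rw [ofReal_margProb_outcomeDist M hρ j.injective]
  have h := sum_mul_unnormalizedPost M ρ j x fun a b => if a = b then 1 else 0
  simp only [ite_mul, one_mul, zero_mul, Finset.sum_ite_eq, Finset.mem_univ, if_true] at h
  refine h.trans (Finset.sum_congr rfl fun u _ => Finset.sum_congr rfl fun v _ => ?_)
  rw [ite_mul, zero_mul]
  refine ite_congr_of_iff ?_ rfl
  rw [funext_iff, Subtype.forall]

theorem outcomeProb_eq_margProb (hρ : ρ.PosSemidef) {m : ℕ} (j : Fin m ↪ Fin n)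
    (x : Fin m → Fin N) : outcomeProb M ρ j x = margProb (outcomeDist M ρ) j x := by
  rw [outcomeProb, ofReal_outcomeProb M hρ, Complex.ofReal_re]

/-- Measuring `j` and then `i` has the same statistics as measuring every site and forgetting the
other outcomes. It lets all later estimates take place in the single classical distribution
`outcomeDist M ρ`. -/
theorem trace_tensorOp_mul_marginal_unnormalizedPost (hρ : ρ.PosSemidef) {m : ℕ}
    (j : Fin m ↪ Fin n) (x : Fin m → Fin N) {κ : Type} [Fintype κ] [DecidableEq κ]
    (i : κ ↪ Rest j) (y : κ → Fin N) :
    (tensorOp (fun l => M.effect (y l)) * marginal (unnormalizedPost M ρ j x) i).trace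
      = margProb (outcomeDist M ρ) (Sum.elim j fun l => (i l : Fin n)) (Sum.elim x y) := by
  have hinj : Function.Injective (Sum.elim j fun l => (i l : Fin n)) := by
    rw [Sum.elim_injective]
    exact ⟨j.injective, Subtype.val_injective.comp i.injective, fun a b => (i b).2 a⟩
  rw [ofReal_margProb_outcomeDist M hρ hinj, trace_tensorOp_mul_marginal,
    sum_mul_unnormalizedPost M ρ j x fun a b => if ∀ s, (∀ l, i l ≠ s) → a s = b s then
      ∏ l, M.effect (y l) (b (i l)) (a (i l)) else 0]
  refine Finset.sum_congr rfl fun u _ => Finset.sum_congr rfl fun v _ => ?_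
  rw [← mul_assoc]
  congr 1
  rw [ite_mul, zero_mul]
  refine ite_congr_of_iff ⟨fun h s hs => ?_, fun h s hs => ?_⟩ ?_
  · exact h ⟨s, fun l => hs (Sum.inl l)⟩ fun l hl => hs (Sum.inr l) (congrArg Subtype.val hl)
  · refine h s fun l => ?_
    cases l with
    | inl l => exact s.2 l
    | inr l => exact fun hl => hs l (Subtype.ext hl)
  · rw [Fintype.prod_sum_type, mul_comm]
    rfl

theorem marginal_smul {ι κ : Type} [Fintype ι] [DecidableEq ι] [Fintype κ] (c : ℂ)
    (σ : QuditOp d ι) (i : κ ↪ ι) : marginal (c • σ) i = c • marginal σ i := by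
  ext a b
  simp only [marginal, Matrix.of_apply, Matrix.smul_apply, smul_eq_mul, Finset.mul_sum, mul_ite,
    mul_zero]

theorem apply_marginal_postState (hρ : ρ.PosSemidef) {m k : ℕ}
    (j : Fin m ↪ Fin n) (x : Fin m → Fin N) (i : Fin k ↪ Rest j) (y : Fin k → Fin N) :
    M.apply (marginal (postState M ρ j x) i) y
      = ((margProb (outcomeDist M ρ) (Sum.elim j fun l => (i l : Fin n)) (Sum.elim x y)
          / margProb (outcomeDist M ρ) j x : ℝ) : ℂ) := by
  rw [postState, marginal_smul, Measurement.apply, Matrix.mul_smul, Matrix.trace_smul,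
    trace_tensorOp_mul_marginal_unnormalizedPost M hρ, outcomeProb_eq_margProb M hρ]
  push_cast
  rw [smul_eq_mul, div_eq_inv_mul]

theorem trace_tensorOp_mul_tensorOp {κ : Type} [Fintype κ] [DecidableEq κ]
    (A B : κ → Matrix (Fin d) (Fin d) ℂ) :
    (tensorOp A * tensorOp B).trace = ∏ l, (A l * B l).trace := by
  have h : ∀ l, (A l * B l).trace = ∑ c : Fin d × Fin d, A l c.2 c.1 * B l c.1 c.2 := by
    intro l
    rw [Fintype.sum_prod_type, Finset.sum_comm, Matrix.trace]
    simp only [Matrix.diag_apply, Matrix.mul_apply]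
  simp only [h]
  rw [Finset.prod_univ_sum, Fintype.piFinset_univ, trace_tensorOp_mul,
    ← (Equiv.arrowProdEquivProdArrow _ _ _).symm.sum_comp, Fintype.sum_prod_type]
  refine Finset.sum_congr rfl fun u _ => Finset.sum_congr rfl fun v _ => ?_
  rw [tensorOp, Matrix.of_apply, ← Finset.prod_mul_distrib]
  rfl

theorem trace_mul_siteMarginal {ι : Type} [Fintype ι] [DecidableEq ι]
    (A : Matrix (Fin d) (Fin d) ℂ) (σ : QuditOp d ι) (s : ι) :
    (A * siteMarginal σ s).trace
      = (tensorOp (fun _ : Unit => A) * marginal σ ⟨fun _ : Unit => s, fun _ _ _ => rfl⟩).trace := by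
  rw [trace_tensorOp_mul, Matrix.trace, ← (Equiv.funUnique Unit (Fin d)).symm.sum_comp,
    Finset.sum_congr rfl fun a _ => ((Equiv.funUnique Unit (Fin d)).symm.sum_comp _).symm,
    Finset.sum_comm]
  simp only [Matrix.diag_apply, Matrix.mul_apply, Finset.univ_unique, Finset.prod_singleton]
  rfl

theorem apply_tensorOp_siteMarginal (hρ : ρ.PosSemidef) {m k : ℕ}
    (j : Fin m ↪ Fin n) (x : Fin m → Fin N) (i : Fin k ↪ Rest j) (y : Fin k → Fin N) :
    M.apply (tensorOp fun l => siteMarginal (postState M ρ j x) (i l)) y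
      = ((∏ l, margProb (outcomeDist M ρ) (Sum.elim j fun _ : Unit => (i l : Fin n))
            (Sum.elim x fun _ => y l) / margProb (outcomeDist M ρ) j x : ℝ) : ℂ) := by
  rw [Measurement.apply, trace_tensorOp_mul_tensorOp, Complex.ofReal_prod]
  refine Finset.prod_congr rfl fun l _ => ?_
  rw [trace_mul_siteMarginal, postState, marginal_smul, Matrix.mul_smul, Matrix.trace_smul,
    outcomeProb_eq_margProb M hρ]
  have := trace_tensorOp_mul_marginal_unnormalizedPost M hρ j x
    ⟨fun _ : Unit => i l, fun _ _ _ => rfl⟩ fun _ => y l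
  rw [this]
  push_cast
  rw [smul_eq_mul, div_eq_inv_mul]
  rfl

theorem tensorOp_update_apply {κ : Type} [Fintype κ] [DecidableEq κ]
    (A : κ → Matrix (Fin d) (Fin d) ℂ) (s : κ) (X : Matrix (Fin d) (Fin d) ℂ) (a b : κ → Fin d) :
    tensorOp (Function.update A s X) a b
      = X (a s) (b s) * ∏ l ∈ Finset.univ.erase s, A l (a l) (b l) := by
  rw [tensorOp, Matrix.of_apply, ← Finset.mul_prod_erase _ _ (Finset.mem_univ s),
    Function.update_self]
  congr 1
  refine Finset.prod_congr rfl fun l hl => ?_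
  rw [Function.update_of_ne (Finset.ne_of_mem_erase hl)]

/-- The probability of an outcome at one site is at most the trace of the effect times the
probability of the outcomes at the other sites. -/
theorem outcomeDist_update_le (hρ : ρ.PosSemidef) (z : Fin n → Fin N) (s : Fin n) (c : Fin N) :
    outcomeDist M ρ (Function.update z s c)
      ≤ (M.effect c).trace.re * ∑ c', outcomeDist M ρ (Function.update z s c') := by
  set A : Fin n → Matrix (Fin d) (Fin d) ℂ := fun l => M.effect (z l)
  have hup : ∀ c', (fun l => M.effect (Function.update z s c' l))
      = Function.update A s (M.effect c') := by
    intro c'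
    funext l
    rcases eq_or_ne l s with rfl | h
    · simp
    · simp [h, A]
  have h1 : tensorOp (Function.update A s ((M.effect c).trace • 1 - M.effect c))
      = (M.effect c).trace • (∑ c', tensorOp (Function.update A s (M.effect c')))
        - tensorOp (Function.update A s (M.effect c)) := by
    ext a b
    rw [Matrix.sub_apply, Matrix.smul_apply, Matrix.sum_apply]
    simp only [tensorOp_update_apply]
    rw [← Finset.sum_mul, ← Matrix.sum_apply, M.sum_eq_one, Matrix.sub_apply, Matrix.smul_apply]
    simp only [smul_eq_mul]
    ring
  have h2 : (tensorOp (Function.update A s ((M.effect c).trace • 1 - M.effect c))).PosSemidef := by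
    refine tensorOp_posSemidef fun l => ?_
    rcases eq_or_ne l s with rfl | h
    · rw [Function.update_self]
      exact trace_smul_one_sub_posSemidef (M.posSemidef c)
    · rw [Function.update_of_ne h]
      exact M.posSemidef _
  have h3 := trace_mul_nonneg h2 hρ
  rw [h1, Matrix.sub_mul, Matrix.trace_sub, Matrix.smul_mul, Matrix.trace_smul, Finset.sum_mul,
    Matrix.trace_sum] at h3
  have htr : (M.effect c).trace = ((M.effect c).trace.re : ℂ) :=
    Complex.eq_re_of_ofReal_le (r := 0) (by exact_mod_cast (M.posSemidef c).trace_nonneg)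
  rw [htr] at h3
  have h4 := (Complex.nonneg_iff.mp h3).1
  simp only [smul_eq_mul, Complex.sub_re, Complex.re_ofReal_mul, Complex.re_sum, ← hup] at h4
  exact sub_nonneg.mp h4

theorem margProb_elim_le (hρ : ρ.PosSemidef) {κ : Type*} (g : κ → Fin n) (s : Fin n)
    (hg : ∀ l, g l ≠ s) (x : κ → Fin N) (c : Fin N) :
    margProb (outcomeDist M ρ) (Sum.elim g fun _ : Unit => s) (Sum.elim x fun _ => c)
      ≤ (M.effect c).trace.re * margProb (outcomeDist M ρ) g x := by
  classical
  have hz : ∀ (z : Fin n → Fin N) c', Function.update z s c' ∘ g = z ∘ g := fun z c' =>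
    funext fun l => Function.update_of_ne (hg l) _ _
  have hcond : ∀ z : Fin n → Fin N, z ∘ (Sum.elim g fun _ : Unit => s) = Sum.elim x (fun _ => c)
      ↔ z ∘ g = x ∧ z s = c := by
    intro z
    simp [funext_iff]
  -- Strings are grouped by their coordinates other than `s`, each group being represented by its
  -- member with value `c` at `s`.
  have hsplit : ∀ F : (Fin n → Fin N) → ℝ,
      ∑ z, F z = ∑ z, if z s = c then ∑ c', F (Function.update z s c') else 0 := by
    intro F
    rw [← Finset.sum_filter, Finset.sum_sigma']
    refine Finset.sum_bij' (fun z _ => ⟨Function.update z s c, z s⟩)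
      (fun p _ => Function.update p.1 s p.2) ?_ ?_ ?_ ?_ ?_
    · intro z _; simp
    · intro p _; simp
    · intro z _; simp
    · rintro ⟨z, c'⟩ hp
      simp only [Finset.mem_sigma, Finset.mem_filter, Finset.mem_univ, true_and, and_true] at hp
      simp [← hp]
    · intro z _; simp
  rw [margProb, margProb, hsplit fun z => open scoped Classical in
    if z ∘ g = x then outcomeDist M ρ z else 0, Finset.mul_sum]
  refine Finset.sum_le_sum fun z _ => ?_
  simp only [hz]
  by_cases h1 : z s = c
  · by_cases h2 : z ∘ g = x
    · rw [if_pos ((hcond z).mpr ⟨h2, h1⟩), if_pos h1]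
      simp only [if_pos h2]
      have := outcomeDist_update_le M hρ z s c
      rwa [← h1, Function.update_eq_self, h1] at this
    · rw [if_neg fun h => h2 ((hcond z).mp h).1]
      simp [h2]
  · rw [if_neg fun h => h1 ((hcond z).mp h).2, if_neg h1, mul_zero]

theorem outcomeDist_eq_zero_of_trace {z : Fin n → Fin N} {s : Fin n}
    (h : (M.effect (z s)).trace.re = 0) : outcomeDist M ρ z = 0 := by
  have htr : (M.effect (z s)).trace = 0 := by
    rw [Complex.eq_re_of_ofReal_le (r := 0) (z := (M.effect (z s)).trace)
      (by exact_mod_cast (M.posSemidef (z s)).trace_nonneg), h, Complex.ofReal_zero]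
  have h0 := (M.posSemidef (z s)).trace_eq_zero_iff.mp htr
  have : tensorOp (fun l => M.effect (z l)) = 0 := by
    ext a b
    rw [tensorOp, Matrix.of_apply, Matrix.zero_apply]
    exact Finset.prod_eq_zero (Finset.mem_univ s) (by rw [h0]; rfl)
  rw [outcomeDist, Measurement.apply, this, Matrix.zero_mul, Matrix.trace_zero, Complex.zero_re]

end Outcomes

/-! ### The de Finetti theorem -/

theorem traceNorm_sq_le_of_isTomographic {d N : ℕ} (hd : 0 < d) {M : Measurement d N}
    (hM : M.IsTomographic) {k : ℕ} {ξ : QuditOp d (Fin k)} (hξ : ξ.trace = 0) :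
    traceNorm ξ ^ 2 ≤ (18 * (d : ℝ)) ^ k * (∑ y, ‖M.apply ξ y‖) ^ 2 := by
  have hD : (0 : ℝ) < 18 * d := by positivity
  rcases Nat.eq_zero_or_pos k with rfl | hk
  · have : ξ = 0 := by
      ext a b
      rw [Matrix.trace, Fintype.sum_subsingleton _ a] at hξ
      rw [Subsingleton.elim b a]
      exact hξ
    rw [this, traceNorm_zero, zero_pow two_ne_zero]
    positivity
  have hP : 0 < (18 * (d : ℝ)) ^ ((k : ℝ) / 2) := Real.rpow_pos_of_pos hD _
  have h := hM.2 k hk ξ hξ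
  rw [div_mul_eq_mul_div, one_mul, div_le_iff₀ hP] at h
  have h2 := pow_le_pow_left₀ (traceNorm_nonneg ξ) h 2
  have e1 : ((18 * (d : ℝ)) ^ ((k : ℝ) / 2)) ^ 2 = (18 * (d : ℝ)) ^ k := by
    rw [← Real.rpow_natCast, ← Real.rpow_mul hD.le]
    simp
  rwa [mul_pow, e1, mul_comm] at h2

/-- By the Born rule, measuring the reduced state and the product state gives the conditional joint
law and the product of conditional marginals of `outcomeDist M ρ`; the quantum distance thus reduces
to the classical one. -/
theorem sum_outcomeProb_mul_traceNorm_sq_le {d N n : ℕ} (hd : 0 < d) {M : Measurement d N}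
    (hM : M.IsTomographic) {ρ : QuditOp d (Fin n)} (hρ : IsDensity ρ) {m k : ℕ}
    (j : Fin m ↪ Fin n) (i : Fin k ↪ Rest j) :
    ∑ x, outcomeProb M ρ j x * traceNorm (marginal (postState M ρ j x) i
        - tensorOp (fun l => siteMarginal (postState M ρ j x) (i l))) ^ 2
      ≤ (18 * (d : ℝ)) ^ k * (4 * totalCorrelation (outcomeDist M ρ) j fun l => (i l : Fin n)) := by
  set p := outcomeDist M ρ
  have hp : ∀ z, 0 ≤ p z := outcomeDist_nonneg M hρ.1
  refine le_trans ?_ (mul_le_mul_of_nonneg_left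
    (sum_margProb_mul_sq_le_totalCorrelation hp j fun l => (i l : Fin n)) (by positivity))
  rw [Finset.mul_sum]
  refine Finset.sum_le_sum fun x _ => ?_
  rw [outcomeProb_eq_margProb M hρ.1, mul_left_comm]
  rcases (margProb_nonneg hp j x).eq_or_lt with h0 | h0
  · rw [← h0, zero_mul, zero_mul]
  refine mul_le_mul_of_nonneg_left ?_ h0.le
  set ξ := marginal (postState M ρ j x) i
    - tensorOp (fun l => siteMarginal (postState M ρ j x) (i l))
  have happ : ∀ y, M.apply ξ y
      = ((margProb p (Sum.elim j fun l => (i l : Fin n)) (Sum.elim x y) / margProb p j x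
          - ∏ l, margProb p (Sum.elim j fun _ : Unit => (i l : Fin n)) (Sum.elim x fun _ => y l)
            / margProb p j x : ℝ) : ℂ) := by
    intro y
    rw [Complex.ofReal_sub, ← apply_marginal_postState M hρ.1, ← apply_tensorOp_siteMarginal M hρ.1,
      Measurement.apply, Matrix.mul_sub, Matrix.trace_sub]
    rfl
  -- The trace is the sum of the outcome entries, and both classical laws have total mass one.
  have hξ : ξ.trace = 0 := by
    rw [← sum_apply M ξ, Finset.sum_congr rfl fun y _ => happ y, ← Complex.ofReal_sum,
      Finset.sum_sub_distrib, ← Finset.sum_div, sum_margProb_elim, div_self h0.ne']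
    have e := Finset.prod_univ_sum (fun _ : Fin k => (Finset.univ : Finset (Fin N))) fun l c =>
      margProb p (Sum.elim j fun _ : Unit => (i l : Fin n)) (Sum.elim x fun _ => c) / margProb p j x
    rw [Fintype.piFinset_univ] at e
    rw [← e, Finset.prod_eq_one, sub_self, Complex.ofReal_zero]
    intro l _
    rw [← Finset.sum_div, sum_margProb_elim_unit, div_self h0.ne']
  refine (traceNorm_sq_le_of_isTomographic hd hM hξ).trans (le_of_eq ?_)
  simp only [happ, Complex.norm_real, Real.norm_eq_abs]

theorem meanSqDistToProduct_le {d N n : ℕ} (hd : 0 < d) {M : Measurement d N}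
    (hM : M.IsTomographic) {ρ : QuditOp d (Fin n)} (hρ : IsDensity ρ) (m k : ℕ) :
    meanSqDistToProduct M ρ k m ≤ (18 * (d : ℝ)) ^ k * (4 *
      𝔼 j : Fin m ↪ Fin n, 𝔼 i : Fin k ↪ Rest j,
        totalCorrelation (outcomeDist M ρ) j fun l => (i l : Fin n)) := by
  rw [meanSqDistToProduct]
  simp only [Finset.mul_expect]
  refine Finset.expect_le_expect fun j _ => ?_
  rw [← Finset.expect_sum_comm]
  exact Finset.expect_le_expect fun i _ => sum_outcomeProb_mul_traceNorm_sq_le hd hM hρ j i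

end DeFinetti

theorem mainTheorem6 (d : ℕ) (hd : 0 < d) :
    (∃ (N : ℕ) (M : DeFinetti.Measurement d N), M.IsTomographic) ∧
    ∀ (N : ℕ) (M : DeFinetti.Measurement d N), M.IsTomographic →
      ∀ (n k : ℕ) (ρ : DeFinetti.QuditOp d (Fin n)), DeFinetti.IsDensity ρ →
        ∀ t : ℕ, 1 ≤ t → t + k ≤ n →
          ∃ m : ℕ, m ≤ t ∧
            DeFinetti.meanSqDistToProduct M ρ k m ≤
              4 * Real.log d * (18 * (d : ℝ)) ^ k * (k : ℝ) ^ 2 / (t : ℝ) := by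
  refine ⟨DeFinetti.exists_isTomographic hd, fun N M hM n k ρ hρ t ht htk => ?_⟩
  have hd0 : (0 : ℝ) < d := by exact_mod_cast hd
  have hlog : 0 ≤ Real.log d := Real.log_natCast_nonneg d
  have ht0 : (0 : ℝ) < t := by exact_mod_cast ht
  -- The outcome law of the maximally mixed qudit; with it the domination constant is `D = d`,
  -- whatever `N` is.
  let q : Fin N → ℝ := fun c => (M.effect c).trace.re / d
  have hq : ∀ c, 0 ≤ q c := fun c =>
    div_nonneg (Complex.nonneg_iff.mp (M.posSemidef c).trace_nonneg).1 hd0.le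
  have hq1 : ∑ c, q c = 1 := by
    rw [← Finset.sum_div, ← Complex.re_sum, ← Matrix.trace_sum, M.sum_eq_one, Matrix.trace_one,
      Fintype.card_fin, Complex.natCast_re, div_self hd0.ne']
  obtain ⟨G, hG⟩ := DeFinetti.meanNegEntropy_succ_sub (D := d)
    (DeFinetti.outcomeDist_nonneg M hρ.1) (DeFinetti.sum_outcomeDist M hρ) hq hq1
    (fun z s h => DeFinetti.outcomeDist_eq_zero_of_trace M
      ((div_eq_zero_iff.mp h).resolve_right hd0.ne')) hd0
    (fun r g s hg x c => by
      have h := DeFinetti.margProb_elim_le M hρ.1 g s hg x c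
      rwa [← mul_div_cancel₀ (M.effect c).trace.re hd0.ne'] at h)
  obtain ⟨m, hm, hle⟩ := DeFinetti.exists_second_difference_le htk hlog hG
  refine ⟨m, hm, (DeFinetti.meanSqDistToProduct_le hd hM hρ m k).trans ?_⟩
  rw [DeFinetti.expect_totalCorrelation _ (by omega)]
  -- Averaging over the `t + 1` values `0, …, t` gives the slightly better denominator `t + 1`.
  have h1 : (k : ℝ) ^ 2 * Real.log d / (t + 1) ≤ (k : ℝ) ^ 2 * Real.log d / t :=
    div_le_div_of_nonneg_left (by positivity) ht0 (by linarith)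
  calc _ ≤ (18 * (d : ℝ)) ^ k * (4 * ((k : ℝ) ^ 2 * Real.log d / t)) := by
        gcongr
        exact hle.trans h1
    _ = _ := by ring
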